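/- For $A\in\mathbb{R}^{n\times m}$ consider the constrained zero-sum game with payoff $f(x,y)=x^{T}Ay$, where $x\in\Delta_n$ minimizes and $y\in\Delta_m$ maximizes ($\Delta_k\subset\mathbb{R}^k$ is the probability simplex). A pair $(x,y)\in\Delta_n\times\Delta_m$ is an $\epsilon$-approximate Nash equilibrium if $f(x,y')-\epsilon\le f(x,y)\le f(x',y)+\epsilon$ for all $x'\in\Delta_n$, $y'\in\Delta_m$, and a Nash equilibrium if this holds with $\epsilon=0$. All vector norms are Euclidean, and $\gamma=\|A\|$ is the spectral norm. OGDA with learning rate $\eta$ is the recursion $$x_t=x_{t-1}-2\eta Ay_{t-1}+\eta Ay_{t-2},\qquad y_t=y_{t-1}+2\eta A^{T}x_{t-1}-\eta A^{T}x_{t-2}\qquad(t\ge 1).$$ A sequence $u_t$ converges linearly to $u^*$ with rate $r\in(0,1)$ if $\lim_{t\to\infty}\|u_{t+1}-u^*\|/\|u_t-u^*\|=r$. The rate of convergence $\lambda=\lambda(A,\eta)$ of OGDA is the largest (slowest) rate with which the joint state $(x_t,y_t)\in\mathbb{R}^{n+m}$ converges linearly, over all initial conditions $(x_{-1},y_{-1}),(x_0,y_0)\in\mathbb{R}^{n+m}$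 from which it converges linearly. Algorithm 1 (parameters $\eta$, $T_p$, $T_s$; input $(x^p_0,y^p_0)\in\Delta_n\times\Delta_m$): for $k=1,\dots,T_p$, run $T_s$ steps of OGDA from $(x_0,y_0)=(x^p_{k-1},y^p_{k-1})$ and $(x_{-1},y_{-1})=(0,0)$, and let $x^p_k$, $y^p_k$ be the Euclidean projections of $x_{T_s}$ onto $\Delta_n$ and of $y_{T_s}$ onto $\Delta_m$. Return $(x^p_{T_p},y^p_{T_p})$. Theorem. There is an absolute constant $C>0$ such that the following holds. Let $A\ne 0$ be such that the constrained game has an equilibrium $(x^*,y^*)$ with all entries of $x^*$ and $y^*$ positive, and has value $\min_{x\in\Delta_n}\max_{y\in\Delta_m}x^{T}Ay=0$. Then there is $\alpha\in(0,1)$, depending only on $A$, such that for every learning rate $0<\eta<1/(2\gamma)$ the rate $\lambda\in(0,1)$ of OGDA exists (the maximum defining it is attained), and there are functions $T_p,T_s:(0,\infty)\to\mathbb{N}$ with the following properties. 1. For every $\epsilon>0$ and every starting point $(x_0^p,y_0^p)\in\Delta_n\times\Delta_m$, Algorithm 1 with $T_p(\epsilon)$ cycles of $T_s(\epsilon)$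 OGDA steps each returns an $\epsilon$-approximate Nash equilibrium. 2. For every $0<\epsilon\le 1/2$, $$T_p(\epsilon)\le C\,\frac{\log(1/\epsilon)}{\log(1/\alpha)},\qquad T_s(\epsilon)\le C\,\frac{\log\bigl(1/((1-\alpha)\epsilon)\bigr)}{\log(1/\lambda)}.$$ 3. Counting each projection onto the simplices as one iteration, the total number of iterations satisfies $T_p(\epsilon)\,(T_s(\epsilon)+1)=O(\log^2(1/\epsilon))$ as $\epsilon\to0^+$, for fixed $A$ and $\eta$ (in particular it is $\widetilde{O}(\log^2(1/\epsilon))$). -/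

import Mathlib

open Filter Topology Asymptotics

noncomputable section

namespace BilinearGame

/-- `ℝᵏ` with the Euclidean norm. -/
abbrev Vec (k : ℕ) : Type := EuclideanSpace ℝ (Fin k)

/-- The probability simplex `Δ_k ⊆ ℝᵏ`. -/
def simplex (k : ℕ) : Set (Vec k) := {p | (∀ i, 0 ≤ p i) ∧ ∑ i, p i = 1}

/-- The linear map `y ↦ A y`. -/
def act {n m : ℕ} (A : Matrix (Fin n) (Fin m) ℝ) : Vec m →ₗ[ℝ] Vec n :=
  Matrix.toEuclideanLin A

/-- The objective `f(x, y) = xᵀ A y`, paid by the minimizer `x` to the maximizer `y`. -/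
def payoff {n m : ℕ} (A : Matrix (Fin n) (Fin m) ℝ) (x : Vec n) (y : Vec m) : ℝ :=
  ∑ i, ∑ j, x i * A i j * y j

/-- The spectral norm of `A`: the operator norm with respect to the Euclidean norms. -/
def specNorm {n m : ℕ} (A : Matrix (Fin n) (Fin m) ℝ) : ℝ :=
  ‖LinearMap.toContinuousLinearMap (act A)‖

/-- `(x, y)` is an `ε`-approximate Nash equilibrium of the constrained game. -/
def IsApproxNash {n m : ℕ} (A : Matrix (Fin n) (Fin m) ℝ) (ε : ℝ) (x : Vec n) (y : Vec m) :
    Prop :=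
  x ∈ simplex n ∧ y ∈ simplex m ∧
    (∀ y' ∈ simplex m, payoff A x y' ≤ payoff A x y + ε) ∧
    (∀ x' ∈ simplex n, payoff A x y ≤ payoff A x' y + ε)

/-- `(x, y)` is a Nash equilibrium of the constrained game. -/
def IsNash {n m : ℕ} (A : Matrix (Fin n) (Fin m) ℝ) (x : Vec n) (y : Vec m) : Prop :=
  x ∈ simplex n ∧ y ∈ simplex m ∧
    (∀ y' ∈ simplex m, payoff A x y' ≤ payoff A x y) ∧
    (∀ x' ∈ simplex n, payoff A x y ≤ payoff A x' y)

/-- The constrained game has an equilibrium in which every action has positive probability. -/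
def HasInteriorEquilibrium {n m : ℕ} (A : Matrix (Fin n) (Fin m) ℝ) : Prop :=
  ∃ x y, IsNash A x y ∧ (∀ i, 0 < x i) ∧ (∀ j, 0 < y j)

/-- The value `min_{x ∈ Δ_n} max_{y ∈ Δ_m} xᵀ A y` of the constrained game. -/
def value {n m : ℕ} (A : Matrix (Fin n) (Fin m) ℝ) : ℝ :=
  ⨅ x : simplex n, ⨆ y : simplex m, payoff A x y

/-- One step of OGDA; `z = (x_{t-1}, y_{t-1})` and `w = (x_{t-2}, y_{t-2})`. -/
def ogdaStep {n m : ℕ} (A : Matrix (Fin n) (Fin m) ℝ) (η : ℝ) (z w : Vec n × Vec m) :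
    Vec n × Vec m :=
  (z.1 - (2 * η) • act A z.2 + η • act A w.2,
   z.2 + (2 * η) • act A.transpose z.1 - η • act A.transpose w.1)

/-- The OGDA trajectory `t ↦ (x_t, y_t)`, `t ≥ 0`, with initial conditions
`w = (x_{-1}, y_{-1})` and `z = (x_0, y_0)`. -/
def ogda {n m : ℕ} (A : Matrix (Fin n) (Fin m) ℝ) (η : ℝ) (w z : Vec n × Vec m) :
    ℕ → Vec n × Vec m
  | 0 => z
  | 1 => ogdaStep A η z w
  | t + 2 => ogdaStep A η (ogda A η w z (t + 1)) (ogda A η w z t)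

/-- The sequence `u` converges linearly to `l` with rate `r ∈ (0, 1)`. As `r > 0`, the quotients
are eventually genuine ones, and as `r < 1`, the sequence does converge to `l`. -/
def ConvergesLinearly {E : Type*} [NormedAddCommGroup E] (u : ℕ → E) (l : E) (r : ℝ) : Prop :=
  0 < r ∧ r < 1 ∧ Tendsto (fun t => ‖u (t + 1) - l‖ / ‖u t - l‖) atTop (𝓝 r)

/-- The rates of linear convergence that OGDA exhibits from its various initial conditions. The
joint state `(x_t, y_t)` lives in `ℝⁿ × ℝᵐ` with the Euclidean norm. -/
def ogdaRates {n m : ℕ} (A : Matrix (Fin n) (Fin m) ℝ) (η : ℝ) : Set ℝ :=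
  {r | ∃ (w z : Vec n × Vec m) (l : WithLp 2 (Vec n × Vec m)),
    ConvergesLinearly (fun t => WithLp.toLp 2 (ogda A η w z t)) l r}

/-- The rate of convergence of OGDA: the slowest rate over all initial conditions. -/
def ogdaRate {n m : ℕ} (A : Matrix (Fin n) (Fin m) ℝ) (η : ℝ) : ℝ := sSup (ogdaRates A η)

/-- The Euclidean projection `argmin_{p ∈ Δ_k} ‖u - p‖` (it exists and is unique for `k ≥ 1`). -/
def projSimplex {k : ℕ} (u : Vec k) : Vec k :=
  Classical.epsilon fun p => p ∈ simplex k ∧ ∀ q ∈ simplex k, ‖u - p‖ ≤ ‖u - q‖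

/-- The iterates `k ↦ (x_k^p, y_k^p)` of the algorithm, started at `z`: each cycle runs `Ts` steps
of OGDA from the current point, with `x_{-1} = 0` and `y_{-1} = 0`, and then projects onto the
simplexes. After `Tp` cycles the algorithm returns `altProj A η Ts z Tp`. -/
def altProj {n m : ℕ} (A : Matrix (Fin n) (Fin m) ℝ) (η : ℝ) (Ts : ℕ) (z : Vec n × Vec m) :
    ℕ → Vec n × Vec m
  | 0 => z
  | k + 1 =>
    (projSimplex (ogda A η 0 (altProj A η Ts z k) Ts).1,
     projSimplex (ogda A η 0 (altProj A η Ts z k) Ts).2)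

end BilinearGame

end

/-! With both players stacked into one state `z`, OGDA is the two-step iteration `z'' = z' + 2ηMz' -
ηMz` of a single skew-adjoint operator `M` (`gameOp`). Since `-M²` is symmetric, there is an
orthonormal basis of vectors `e` for which `M` acts on the plane of `e` and `M e` as multiplication
by `i‖M e‖`. There the iteration is a scalar complex recursion with `s = η‖M e‖ < 1/2`, whose
dominant root has modulus `modeRate s`, decreasing in `s`. The slowest moving mode therefore gives
the rate, which the powers of its dominant root attain. Kernel components do not move, so the limit
is the orthogonal projection of the start onto `ker Aᵀ × ker A`.

By complementary slackness an interior equilibrium of a game of value zero lies in these kernels.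
The algorithm is thus an inexact alternating projection between kernel and simplex, separately for
each player. As the kernel meets the relative interior of the simplex, the pair is linearly regular
(`exists_linear_regularity`), and a cycle contracts the distance to the intersection by a fixed
factor, up to the OGDA error (`exists_contraction`). Points near these intersections form an
approximate equilibrium.

Two devices keep `C` absolute. `norm_even_le_modeRate` gives up half of the OGDA steps to pay for
nearly coalescing roots. `exists_rate_absorbing` moves the contraction factor closer to 1, so that
`α` absorbs every constant depending on `A`. -/

noncomputable section

namespace BilinearGame

/-! ### The scalar recursion of one singular mode -/

/-- The square root of the discriminant of the characteristic polynomial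
`μ² - (1 + 2is) μ + is`. -/
def modeDisc (s : ℝ) : ℝ := √(1 - 4 * s ^ 2)

/-- The root of larger modulus. -/
def rootPlus (s : ℝ) : ℂ := ⟨(1 + modeDisc s) / 2, s⟩

/-- The root of smaller modulus. -/
def rootMinus (s : ℝ) : ℂ := ⟨(1 - modeDisc s) / 2, s⟩

/-- The modulus of `rootPlus s`. -/
def modeRate (s : ℝ) : ℝ := √((1 + modeDisc s) / 2)

lemma modeDisc_nonneg (s : ℝ) : 0 ≤ modeDisc s := Real.sqrt_nonneg _

lemma modeDisc_sq {s : ℝ} (h0 : 0 ≤ s) (h : s < 1 / 2) : modeDisc s ^ 2 = 1 - 4 * s ^ 2 :=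
  Real.sq_sqrt (by nlinarith)

lemma modeDisc_pos {s : ℝ} (h0 : 0 ≤ s) (h : s < 1 / 2) : 0 < modeDisc s :=
  Real.sqrt_pos.2 (by nlinarith)

lemma modeDisc_lt_one {s : ℝ} (h0 : 0 < s) (h : s < 1 / 2) : modeDisc s < 1 := by
  have := modeDisc_sq h0.le h
  have := modeDisc_nonneg s
  nlinarith [sq_nonneg s, mul_pos h0 h0]

lemma modeRate_sq (s : ℝ) : modeRate s ^ 2 = (1 + modeDisc s) / 2 :=
  Real.sq_sqrt (by linarith [modeDisc_nonneg s])

lemma modeRate_nonneg (s : ℝ) : 0 ≤ modeRate s := Real.sqrt_nonneg _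

/-- A rate bounded away from 0 ensures that rounding step counts up costs only a constant factor. -/
lemma half_lt_modeRate (s : ℝ) : 1 / 2 < modeRate s := by
  have h1 := modeRate_sq s
  have h2 := modeDisc_nonneg s
  have h3 := modeRate_nonneg s
  nlinarith

lemma modeRate_lt_one {s : ℝ} (h0 : 0 < s) (h : s < 1 / 2) : modeRate s < 1 := by
  have h1 := modeRate_sq s
  have h2 := modeDisc_lt_one h0 h
  have h3 := modeRate_nonneg s
  nlinarith

/-- This is why the smallest nonzero `‖M e‖` determines the rate. -/
lemma modeRate_anti {s t : ℝ} (h0 : 0 ≤ s) (h : s ≤ t) : modeRate t ≤ modeRate s := by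
  unfold modeRate modeDisc
  gcongr

/-- Since `modeDisc s ^ 2 = 1 - 4 * s ^ 2`, the squared modulus of this root equals its real part.
-/
lemma norm_rootPlus {s : ℝ} (h0 : 0 ≤ s) (h : s < 1 / 2) : ‖rootPlus s‖ = modeRate s := by
  rw [← sq_eq_sq₀ (norm_nonneg _) (modeRate_nonneg s), modeRate_sq, Complex.sq_norm,
    Complex.normSq_apply]
  simp only [rootPlus]
  linarith [modeDisc_sq h0 h]

lemma norm_rootMinus_le {s : ℝ} (h0 : 0 ≤ s) (h : s < 1 / 2) : ‖rootMinus s‖ ≤ modeRate s := by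
  rw [← sq_le_sq₀ (norm_nonneg _) (modeRate_nonneg s), modeRate_sq, Complex.sq_norm,
    Complex.normSq_apply]
  simp only [rootMinus]
  linarith [modeDisc_sq h0 h, modeDisc_nonneg s]

lemma rootPlus_add_rootMinus (s : ℝ) :
    rootPlus s + rootMinus s = 1 + 2 * Complex.I * s := by
  apply Complex.ext <;> simp [rootPlus, rootMinus] <;> ring

lemma rootPlus_mul_rootMinus {s : ℝ} (h0 : 0 ≤ s) (h : s < 1 / 2) :
    rootPlus s * rootMinus s = Complex.I * s := by
  apply Complex.ext <;> simp [rootPlus, rootMinus]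
  · linarith [modeDisc_sq h0 h]
  · ring

lemma rootPlus_sub_rootMinus (s : ℝ) : rootPlus s - rootMinus s = (modeDisc s : ℂ) := by
  apply Complex.ext <;> simp [rootPlus, rootMinus]; ring

/-- The roots satisfy the characteristic equation. -/
lemma rootPlus_sq {s : ℝ} (h0 : 0 ≤ s) (h : s < 1 / 2) :
    rootPlus s ^ 2 = (1 + 2 * Complex.I * s) * rootPlus s - Complex.I * s := by
  rw [← rootPlus_add_rootMinus, ← rootPlus_mul_rootMinus h0 h]
  ring

/-- Solution of a second order linear recursion, in terms of the roots `a`, `b`. -/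
lemma sub_mul_eq_of_recursion {R : Type*} [CommRing R] {a b : R} {u : ℕ → R}
    (hu : ∀ t, u (t + 2) = (a + b) * u (t + 1) - a * b * u t) (t : ℕ) :
    (a - b) * u t = (u 1 - b * u 0) * a ^ t - (u 1 - a * u 0) * b ^ t := by
  induction t using Nat.twoStepInduction with
  | zero => ring
  | one => ring
  | more t h1 h2 =>
    have : (a - b) * u (t + 2) = (a + b) * ((a - b) * u (t + 1)) - a * b * ((a - b) * u t) := by
      rw [hu]; ring
    rw [this, h1, h2]
    ring

/-- The solution started from a zero state is a geometric sum. -/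
lemma eq_geom_sum_of_recursion {R : Type*} [CommRing R] {a b : R} {u : ℕ → R}
    (hu : ∀ t, u (t + 2) = (a + b) * u (t + 1) - a * b * u t) (h1 : u 1 = (a + b) * u 0) (t : ℕ) :
    u t = (∑ i ∈ Finset.range (t + 1), a ^ i * b ^ (t - i)) * u 0 := by
  have key : ∀ t, ∑ i ∈ Finset.range (t + 2), a ^ i * b ^ (t + 1 - i) =
      a ^ (t + 1) + b * ∑ i ∈ Finset.range (t + 1), a ^ i * b ^ (t - i) := by
    intro t
    rw [Finset.sum_range_succ, Finset.mul_sum, add_comm]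
    congr 1
    · simp
    · refine Finset.sum_congr rfl fun i hi => ?_
      rw [Nat.succ_sub (Nat.lt_succ_iff.1 (Finset.mem_range.1 hi)), pow_succ]
      ring
  induction t using Nat.twoStepInduction with
  | zero => simp
  | one => rw [h1, key 0]; simp
  | more t e1 e2 =>
    rw [hu, e2, e1, key (t + 1), key t]
    ring

section
variable {s : ℝ} {u : ℕ → ℂ}

/-- Along the recursion of a mode, solutions decay at the rate of the mode. -/
lemma exists_norm_le_modeRate (h0 : 0 ≤ s) (h : s < 1 / 2)
    (hu : ∀ t, u (t + 2) = u (t + 1) + 2 * Complex.I * s * u (t + 1) - Complex.I * s * u t) :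
    ∃ K, 0 ≤ K ∧ ∀ t, ‖u t‖ ≤ K * modeRate s ^ t := by
  have hd := modeDisc_pos h0 h
  have hu' : ∀ t, u (t + 2) = (rootPlus s + rootMinus s) * u (t + 1)
      - rootPlus s * rootMinus s * u t := by
    intro t
    rw [hu, rootPlus_add_rootMinus, rootPlus_mul_rootMinus h0 h]; ring
  refine ⟨(‖u 1 - rootMinus s * u 0‖ + ‖u 1 - rootPlus s * u 0‖) / modeDisc s, by positivity,
    fun t => ?_⟩
  have e := sub_mul_eq_of_recursion hu' t
  rw [rootPlus_sub_rootMinus] at e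
  have e2 := congrArg norm e
  rw [norm_mul, Complex.norm_real, Real.norm_of_nonneg hd.le] at e2
  rw [div_mul_eq_mul_div, le_div_iff₀ hd, mul_comm, e2]
  refine (norm_sub_le _ _).trans ?_
  rw [norm_mul, norm_mul, norm_pow, norm_pow, norm_rootPlus h0 h, add_mul]
  gcongr
  exact norm_rootMinus_le h0 h

/-- A uniform decay estimate for the recursion of a mode started from a zero state. -/
lemma norm_even_le_modeRate (h0 : 0 ≤ s) (h : s < 1 / 2) (hr : modeRate s ≤ 1)
    (hu : ∀ t, u (t + 2) = u (t + 1) + 2 * Complex.I * s * u (t + 1) - Complex.I * s * u t)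
    (h1 : u 1 = u 0 + 2 * Complex.I * s * u 0) (t : ℕ) :
    ‖u (2 * t)‖ ≤ 16 * modeRate s ^ t * ‖u 0‖ := by
  have hu' : ∀ t, u (t + 2) = (rootPlus s + rootMinus s) * u (t + 1)
      - rootPlus s * rootMinus s * u t := by
    intro t
    rw [hu, rootPlus_add_rootMinus, rootPlus_mul_rootMinus h0 h]; ring
  have hu1 : u 1 = (rootPlus s + rootMinus s) * u 0 := by
    rw [h1, rootPlus_add_rootMinus]; ring
  have hρ := modeRate_nonneg s
  have hm := norm_rootMinus_le h0 h
  have hp := norm_rootPlus h0 h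
  rw [eq_geom_sum_of_recursion hu' hu1 (2 * t), norm_mul]
  refine mul_le_mul_of_nonneg_right ?_ (norm_nonneg _)
  -- Either the roots are at least `1/2` apart and the geometric sum is a quotient by their
  -- difference, or they may nearly coincide and the sum is bounded termwise. In the second case the
  -- factor `2t + 1` is absorbed by half of the `2t` steps.
  rcases le_total (1 / 2) (modeDisc s) with hd | hd
  · have e := (Commute.all (rootPlus s) (rootMinus s)).geom_sum₂_mul (2 * t + 1)
    simp only [Nat.add_sub_cancel, rootPlus_sub_rootMinus] at e
    have e2 := congrArg norm e
    rw [norm_mul, Complex.norm_real, Real.norm_of_nonneg (modeDisc_nonneg s)] at e2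
    have h3 : ‖rootPlus s ^ (2 * t + 1) - rootMinus s ^ (2 * t + 1)‖ ≤ 2 * modeRate s ^ t := by
      refine (norm_sub_le _ _).trans ?_
      have h4 : modeRate s ^ (2 * t + 1) ≤ modeRate s ^ t :=
        pow_le_pow_of_le_one hρ hr (by omega)
      have h5 : ‖rootMinus s‖ ^ (2 * t + 1) ≤ modeRate s ^ (2 * t + 1) := by gcongr
      rw [norm_pow, norm_pow, hp]
      linarith
    have := norm_nonneg (∑ i ∈ Finset.range (2 * t + 1), rootPlus s ^ i * rootMinus s ^ (2 * t - i))
    have : 0 ≤ modeRate s ^ t := by positivity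
    nlinarith
  · have hsum : ‖∑ i ∈ Finset.range (2 * t + 1), rootPlus s ^ i * rootMinus s ^ (2 * t - i)‖ ≤
        (2 * t + 1) * modeRate s ^ (2 * t) := by
      refine (norm_sum_le _ _).trans ((Finset.sum_le_card_nsmul _ _ (modeRate s ^ (2 * t)) ?_).trans
        (by simp))
      intro i hi
      rw [norm_mul, norm_pow, norm_pow, hp]
      calc modeRate s ^ i * ‖rootMinus s‖ ^ (2 * t - i)
          ≤ modeRate s ^ i * modeRate s ^ (2 * t - i) := by gcongr
        _ = modeRate s ^ (2 * t) := by
          rw [← pow_add]; congr 1; have := Finset.mem_range.1 hi; omega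
    -- Here `modeRate s ^ 2 ≤ 3/4 < 49/64`.
    have hr' : modeRate s ≤ 7 / 8 := by nlinarith [modeRate_sq s]
    have hB : (2 * t + 1) * modeRate s ^ t ≤ 16 := by
      have h6 : modeRate s ^ t ≤ (7 / 8) ^ t := by gcongr
      -- Bernoulli gives `(8/7)^t ≥ 1 + t/7`, hence `(2t + 1)(7/8)^t ≤ 14`.
      have h7 := one_add_mul_le_pow (show (-2 : ℝ) ≤ 1 / 7 by norm_num) t
      have h8 : (7 / 8 : ℝ) ^ t * (1 + 1 / 7) ^ t = 1 := by
        rw [← mul_pow]; norm_num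
      have h9 : (0 : ℝ) < (7 / 8) ^ t := by positivity
      have h10 : (0 : ℝ) ≤ 2 * t + 1 := by positivity
      nlinarith
    refine hsum.trans ?_
    rw [two_mul t, pow_add, ← mul_assoc]
    gcongr

end

/-! ### Optimistic iteration with a skew-adjoint operator -/

open scoped RealInnerProductSpace

section Skew

variable {E : Type*} [NormedAddCommGroup E] [InnerProductSpace ℝ E] {M : E →ₗ[ℝ] E}

/-- `M` is skew-adjoint. -/
def IsSkew (M : E →ₗ[ℝ] E) : Prop := ∀ x y, ⟪M x, y⟫ = -⟪x, M y⟫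

/-- `z` is a trajectory of the optimistic iteration for the vector field `M`. -/
def IsOptimistic (M : E →ₗ[ℝ] E) (η : ℝ) (z : ℕ → E) : Prop :=
  ∀ t, z (t + 2) = z (t + 1) + (2 * η) • M (z (t + 1)) - η • M (z t)

/-- `e` spans, together with `M e`, an invariant subspace on which `M` acts as a multiple of a
rotation. -/
def IsMode (M : E →ₗ[ℝ] E) (e : E) : Prop := M (M e) = -(‖M e‖ ^ 2 • e)

/-- The basis diagonalizes the symmetric operator `-M²`; skewness identifies the eigenvalue of a
unit eigenvector `e` as `‖M e‖²`. -/
lemma IsSkew.exists_orthonormalBasis [FiniteDimensional ℝ E] (hM : IsSkew M) :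
    ∃ e : OrthonormalBasis (Fin (Module.finrank ℝ E)) ℝ E, ∀ i, IsMode M (e i) := by
  have hT : (-(M ∘ₗ M)).IsSymmetric := by
    intro x y
    simp only [LinearMap.neg_apply, LinearMap.comp_apply, inner_neg_left, inner_neg_right]
    rw [hM, hM, neg_neg]
  refine ⟨hT.eigenvectorBasis rfl, fun i => ?_⟩
  set e := hT.eigenvectorBasis rfl
  have h := hT.apply_eigenvectorBasis rfl i
  set v : ℝ := hT.eigenvalues rfl i
  have h1 : M (M (e i)) = -(v • e i) := by
    rw [← neg_eq_iff_eq_neg]; simpa using h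
  have h2 : v = ‖M (e i)‖ ^ 2 := by
    rw [← real_inner_self_eq_norm_sq, hM, h1, inner_neg_right, inner_smul_right,
      real_inner_self_eq_norm_sq, e.norm_eq_one]
    simp
  rw [IsMode, h1, h2]

/-- The complex coordinate of `z` in the plane spanned by `e` and `M e`. -/
def modeCoord (M : E →ₗ[ℝ] E) (e z : E) : ℂ := ⟨⟪e, z⟫, ⟪M e, z⟫ / ‖M e‖⟩

lemma modeCoord_add (e x y : E) : modeCoord M e (x + y) = modeCoord M e x + modeCoord M e y := by
  apply Complex.ext <;> simp [modeCoord, inner_add_right, add_div]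

lemma modeCoord_sub (e x y : E) : modeCoord M e (x - y) = modeCoord M e x - modeCoord M e y := by
  apply Complex.ext <;> simp [modeCoord, inner_sub_right, sub_div]

lemma modeCoord_smul (e x : E) (c : ℝ) : modeCoord M e (c • x) = c * modeCoord M e x := by
  apply Complex.ext <;> simp [modeCoord, inner_smul_right, mul_div_assoc]

lemma sq_norm_modeCoord (e z : E) :
    ‖modeCoord M e z‖ ^ 2 = ⟪e, z⟫ ^ 2 + (⟪M e, z⟫ / ‖M e‖) ^ 2 := by
  rw [Complex.sq_norm, Complex.normSq_apply]
  simp only [modeCoord]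
  ring

lemma abs_inner_le_norm_modeCoord (e z : E) : |⟪e, z⟫| ≤ ‖modeCoord M e z‖ :=
  Complex.abs_re_le_norm (modeCoord M e z)

lemma IsMode.modeCoord_apply {e : E} (hM : IsSkew M) (he : IsMode M e) (h : M e ≠ 0) (z : E) :
    modeCoord M e (M z) = Complex.I * ‖M e‖ * modeCoord M e z := by
  have hn : ‖M e‖ ≠ 0 := norm_ne_zero_iff.2 h
  have h1 : ⟪e, M z⟫ = -⟪M e, z⟫ := by rw [hM, neg_neg]
  have h2 : ⟪M e, M z⟫ = ‖M e‖ ^ 2 * ⟪e, z⟫ := by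
    rw [← neg_neg ⟪M e, M z⟫, ← hM, he, inner_neg_left, real_inner_smul_left, neg_neg]
  apply Complex.ext
  · simp [modeCoord, h1]; field_simp
  · simp [modeCoord, h2]; field_simp

lemma IsMode.modeCoord_recursion {e : E} {η : ℝ} {z : ℕ → E} (hM : IsSkew M) (he : IsMode M e)
    (h : M e ≠ 0) (hz : IsOptimistic M η z) (t : ℕ) :
    modeCoord M e (z (t + 2)) = modeCoord M e (z (t + 1)) +
      2 * Complex.I * (η * ‖M e‖ : ℝ) * modeCoord M e (z (t + 1)) -
      Complex.I * (η * ‖M e‖ : ℝ) * modeCoord M e (z t) := by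
  rw [hz, modeCoord_sub, modeCoord_add, modeCoord_smul, modeCoord_smul,
    he.modeCoord_apply hM h, he.modeCoord_apply hM h]
  push_cast
  ring

/-- Components along the kernel of `M` do not move. -/
lemma IsOptimistic.inner_eq {e : E} {η : ℝ} {z : ℕ → E} (hM : IsSkew M)
    (hz : IsOptimistic M η z) (h0 : ⟪e, z 1⟫ = ⟪e, z 0⟫) (h : M e = 0) (t : ℕ) :
    ⟪e, z t⟫ = ⟪e, z 0⟫ := by
  have hk : ∀ x, ⟪e, M x⟫ = 0 := fun x => by
    rw [← neg_neg ⟪e, M x⟫, ← hM, h]; simp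
  have : ∀ t, ⟪e, z (t + 1)⟫ = ⟪e, z 0⟫ := by
    intro t
    induction t with
    | zero => exact h0
    | succ t ih =>
      rw [hz, inner_sub_right, inner_add_right, inner_smul_right, inner_smul_right, hk, hk, ih]
      ring
  cases t with
  | zero => rfl
  | succ t => exact this t

/-- Modes that move are orthogonal to the kernel of `M`. -/
lemma IsMode.inner_eq_zero {e p : E} (hM : IsSkew M) (he : IsMode M e) (h : M e ≠ 0)
    (hp : M p = 0) : ⟪e, p⟫ = 0 := by
  have hn : ‖M e‖ ^ 2 ≠ 0 := pow_ne_zero _ (norm_ne_zero_iff.2 h)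
  have h1 : ⟪M (M e), p⟫ = 0 := by rw [hM, hp, inner_zero_right, neg_zero]
  rw [he, inner_neg_left, real_inner_smul_left, neg_eq_zero] at h1
  exact (mul_eq_zero.1 h1).resolve_left hn

/-- `p` is the orthogonal projection of `z` onto the kernel of `M`. -/
def IsKerProj (M : E →ₗ[ℝ] E) (z p : E) : Prop := M p = 0 ∧ ∀ q, M q = 0 → ⟪q, z⟫ = ⟪q, p⟫

/-- The images of an orthonormal basis of modes are, once normalized, orthonormal. -/
lemma sum_sq_norm_modeCoord_le {ι : Type*} [Fintype ι] (e : OrthonormalBasis ι ℝ E)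
    (hM : IsSkew M) (he : ∀ i, IsMode M (e i)) (z : E) :
    ∑ i, ‖modeCoord M (e i) z‖ ^ 2 ≤ 2 * ‖z‖ ^ 2 := by
  classical
  simp only [sq_norm_modeCoord, Finset.sum_add_distrib]
  have h1 : ∑ i, ⟪e i, z⟫ ^ 2 = ‖z‖ ^ 2 := by
    rw [← e.sum_sq_norm_inner_right]; simp
  -- Orthogonality follows from `⟪M eᵢ, M eⱼ⟫ = ‖M eᵢ‖² ⟪eᵢ, eⱼ⟫`. Bessel's inequality then bounds
  -- the imaginary parts; modes at rest contribute 0, as division by zero gives 0.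
  let v : {i // M (e i) ≠ 0} → E := fun i => (‖M (e i)‖)⁻¹ • M (e i)
  have hv : Orthonormal ℝ v := by
    rw [orthonormal_iff_ite]
    intro i j
    have hi : ‖M (e i)‖ ≠ 0 := norm_ne_zero_iff.2 i.2
    have hj : ‖M (e j)‖ ≠ 0 := norm_ne_zero_iff.2 j.2
    simp only [v]
    rw [real_inner_smul_left, real_inner_smul_right, ← neg_neg ⟪M (e i), M (e j)⟫, ← hM, he i,
      inner_neg_left, real_inner_smul_left, neg_neg, orthonormal_iff_ite.1 e.orthonormal]
    by_cases hij : i = j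
    · subst hij; simp; field_simp
    · rw [if_neg (fun h => hij (Subtype.ext h)), if_neg hij]; simp
  have h2 : ∑ i, (⟪M (e i), z⟫ / ‖M (e i)‖) ^ 2 ≤ ‖z‖ ^ 2 := by
    have h3 := hv.sum_inner_products_le (x := z) (s := Finset.univ)
    have h4 : ∑ i, (⟪M (e i), z⟫ / ‖M (e i)‖) ^ 2 =
        ∑ i : {i // M (e i) ≠ 0}, (⟪M (e i), z⟫ / ‖M (e i)‖) ^ 2 := by
      rw [← Finset.sum_subtype (Finset.univ.filter fun i => M (e i) ≠ 0) (by simp)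
        fun i => (⟪M (e i), z⟫ / ‖M (e i)‖) ^ 2, Finset.sum_filter_of_ne]
      intro i _ hi h
      simp [h] at hi
    rw [h4]
    refine le_trans (le_of_eq (Finset.sum_congr rfl fun i _ => ?_)) h3
    simp only [v]
    rw [real_inner_smul_left, Real.norm_eq_abs, sq_abs]
    ring
  linarith

section Bounds

variable {ι : Type*} [Fintype ι] (e : OrthonormalBasis ι ℝ E) {η ρ : ℝ} {z : ℕ → E} {p : E}

/-- The component of the error along a mode at rest vanishes. -/
lemma IsOptimistic.inner_sub_eq_zero {v : E} (hM : IsSkew M) (hz : IsOptimistic M η z)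
    (h1 : ∃ w, z 1 = z 0 + M w) (hp : IsKerProj M (z 0) p) (h : M v = 0) (t : ℕ) :
    ⟪v, z t - p⟫ = 0 := by
  obtain ⟨w, hw⟩ := h1
  have h0 : ⟪v, z 1⟫ = ⟪v, z 0⟫ := by
    rw [hw, inner_add_right, ← neg_neg ⟪v, M w⟫, ← hM, h]; simp
  rw [inner_sub_right, hz.inner_eq hM h0 h, hp.2 _ h, sub_self]

/-- The trajectory converges to the projection onto the kernel, geometrically. -/
lemma exists_norm_sub_le_pow (hM : IsSkew M) (he : ∀ i, IsMode M (e i)) (hη : 0 ≤ η)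
    (hs : ∀ i, η * ‖M (e i)‖ < 1 / 2)
    (hρ : ∀ i, M (e i) ≠ 0 → modeRate (η * ‖M (e i)‖) ≤ ρ)
    (hz : IsOptimistic M η z)
    (h1 : ∃ w, z 1 = z 0 + M w) (hp : IsKerProj M (z 0) p) :
    ∃ K, ∀ t, ‖z t - p‖ ≤ K * ρ ^ t := by
  have key : ∀ i, ∃ K, ∀ t, |⟪e i, z t - p⟫| ≤ K * ρ ^ t := by
    intro i
    by_cases h : M (e i) = 0
    · exact ⟨0, by simp [hz.inner_sub_eq_zero hM h1 hp h]⟩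
    · obtain ⟨K, hK, hb⟩ := exists_norm_le_modeRate (s := η * ‖M (e i)‖)
        (u := fun t => modeCoord M (e i) (z t)) (by positivity) (hs i)
        ((he i).modeCoord_recursion hM h hz)
      refine ⟨K, fun t => ?_⟩
      rw [inner_sub_right, (he i).inner_eq_zero hM h hp.1, sub_zero]
      refine (abs_inner_le_norm_modeCoord _ _).trans ((hb t).trans ?_)
      have := modeRate_nonneg (η * ‖M (e i)‖)
      gcongr
      exact hρ i h
  choose K hK using key
  refine ⟨∑ i, K i, fun t => ?_⟩
  calc ‖z t - p‖ = ‖∑ i, ⟪e i, z t - p⟫ • e i‖ := by rw [e.sum_repr']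
    _ ≤ ∑ i, ‖⟪e i, z t - p⟫ • e i‖ := norm_sum_le _ _
    _ ≤ ∑ i, K i * ρ ^ t := by
      refine Finset.sum_le_sum fun i _ => ?_
      rw [norm_smul, e.norm_eq_one, mul_one]
      exact hK i t
    _ = _ := by rw [Finset.sum_mul]

/-- A uniform estimate for trajectories started from a zero state. -/
lemma norm_even_sub_le_pow (hM : IsSkew M) (he : ∀ i, IsMode M (e i)) (hη : 0 ≤ η)
    (hs : ∀ i, η * ‖M (e i)‖ < 1 / 2)
    (hρ : ∀ i, M (e i) ≠ 0 → modeRate (η * ‖M (e i)‖) ≤ ρ) (hρ0 : 0 ≤ ρ) (hρ1 : ρ ≤ 1)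
    (hz : IsOptimistic M η z)
    (h1 : z 1 = z 0 + (2 * η) • M (z 0)) (hp : IsKerProj M (z 0) p) (t : ℕ) :
    ‖z (2 * t) - p‖ ≤ 32 * ρ ^ t * ‖z 0‖ := by
  have h1' : ∃ w, z 1 = z 0 + M w := ⟨(2 * η) • z 0, by rw [h1, map_smul]⟩
  have key : ∀ i, ⟪e i, z (2 * t) - p⟫ ^ 2 ≤ (16 * ρ ^ t) ^ 2 * ‖modeCoord M (e i) (z 0)‖ ^ 2 := by
    intro i
    by_cases h : M (e i) = 0
    · rw [hz.inner_sub_eq_zero hM h1' hp h, zero_pow two_ne_zero]; positivity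
    · rw [inner_sub_right, (he i).inner_eq_zero hM h hp.1, sub_zero, ← mul_pow, ← sq_abs]
      have hr := hρ i h
      have := modeRate_nonneg (η * ‖M (e i)‖)
      have hb := norm_even_le_modeRate (s := η * ‖M (e i)‖)
        (u := fun t => modeCoord M (e i) (z t)) (by positivity) (hs i) (hr.trans hρ1)
        ((he i).modeCoord_recursion hM h hz)
        (by rw [h1, modeCoord_add, modeCoord_smul, (he i).modeCoord_apply hM h]; push_cast; ring) t
      gcongr
      refine (abs_inner_le_norm_modeCoord _ _).trans (hb.trans ?_)
      gcongr
  rw [← sq_le_sq₀ (norm_nonneg _) (by positivity), ← e.sum_sq_norm_inner_right]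
  simp only [Real.norm_eq_abs, sq_abs]
  refine (Finset.sum_le_sum fun i _ => key i).trans ?_
  rw [← Finset.mul_sum]
  -- The planes of different modes may overlap, which costs a factor 2 in the square; `16√2 ≤ 32`.
  have := sum_sq_norm_modeCoord_le e hM he (z 0)
  have h5 : 0 ≤ (16 * ρ ^ t) ^ 2 := sq_nonneg _
  nlinarith [mul_nonneg h5 (sq_nonneg ‖z 0‖)]

end Bounds

/-- A moving mode carries a trajectory whose norm is a geometric sequence. -/
lemma IsMode.exists_trajectory {e : E} {η : ℝ} (hM : IsSkew M) (he : IsMode M e)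
    (h : M e ≠ 0) (hn : ‖e‖ = 1) (hη : 0 ≤ η) (hs : η * ‖M e‖ < 1 / 2) :
    ∃ z : ℕ → E, IsOptimistic M η z ∧ ∀ t, ‖z t‖ = modeRate (η * ‖M e‖) ^ t := by
  have hm : ‖M e‖ ≠ 0 := norm_ne_zero_iff.2 h
  set s := η * ‖M e‖ with hsdef
  have hs0 : 0 ≤ s := by positivity
  have hee : ⟪e, M e⟫ = 0 := by
    have := hM e e
    rw [real_inner_comm] at this
    linarith
  -- An isometric embedding of `ℂ` onto the plane of the mode, intertwining multiplication by `i‖M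
  -- e‖` with `M`. It carries powers of the dominant root to a trajectory.
  let φ : ℂ → E := fun ζ => ζ.re • e + (ζ.im / ‖M e‖) • M e
  have hφM : ∀ ζ, M (φ ζ) = φ (Complex.I * ‖M e‖ * ζ) := by
    intro ζ
    simp only [φ, map_add, map_smul]
    rw [he]
    simp
    rw [smul_smul, add_comm, ← neg_smul, ← neg_smul]
    congr 2
    · field_simp
    · field_simp
  have hφadd : ∀ a b, φ (a + b) = φ a + φ b := fun a b => by
    simp only [φ, Complex.add_re, Complex.add_im, add_div, add_smul]; abel
  have hφsub : ∀ a b, φ (a - b) = φ a - φ b := fun a b => by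
    simp only [φ, Complex.sub_re, Complex.sub_im, sub_div, sub_smul]; abel
  have hφsmul : ∀ (c : ℝ) a, φ (c * a) = c • φ a := fun c a => by
    simp [φ, mul_div_assoc, smul_smul]
  have hφn : ∀ ζ, ‖φ ζ‖ = ‖ζ‖ := by
    intro ζ
    rw [← sq_eq_sq₀ (norm_nonneg _) (norm_nonneg _), Complex.sq_norm, Complex.normSq_apply]
    simp only [φ]
    rw [norm_add_sq_real, real_inner_smul_left, real_inner_smul_right, hee, norm_smul, norm_smul,
      hn, mul_pow, mul_pow, Real.norm_eq_abs, Real.norm_eq_abs, sq_abs, sq_abs]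
    field_simp
    ring
  refine ⟨fun t => φ (rootPlus s ^ t), fun t => ?_, fun t => ?_⟩
  · simp only
    rw [hφM, hφM, ← hφsmul, ← hφsmul, ← hφadd, ← hφsub]
    congr 1
    rw [pow_add, rootPlus_sq hs0 hs, hsdef]
    push_cast
    ring
  · rw [hφn, norm_pow, norm_rootPlus hs0 hs]

end Skew

/-! ### The simplex and inexact alternating projections -/

section Simplex

variable {k : ℕ}

lemma convex_simplex (k : ℕ) : Convex ℝ (simplex k) := by
  rintro x ⟨hx, hx1⟩ y ⟨hy, hy1⟩ a b ha hb hab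
  refine ⟨fun i => ?_, ?_⟩
  · have := hx i
    have := hy i
    simp only [PiLp.add_apply, PiLp.smul_apply, smul_eq_mul]
    positivity
  · simp only [PiLp.add_apply, PiLp.smul_apply, smul_eq_mul, Finset.sum_add_distrib,
      ← Finset.mul_sum, hx1, hy1, mul_one, hab]

lemma isClosed_simplex (k : ℕ) : IsClosed (simplex k) := by
  have h : simplex k = (⋂ i, {p : Vec k | 0 ≤ p i}) ∩ {p | ∑ i, p i = 1} := by
    ext p; simp [simplex]
  rw [h]
  refine (isClosed_iInter fun i => isClosed_le continuous_const (by fun_prop)).inter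
    (isClosed_eq (by fun_prop) continuous_const)

lemma le_one_of_mem_simplex {x : Vec k} (hx : x ∈ simplex k) (i : Fin k) : x i ≤ 1 := by
  rw [← hx.2]
  exact Finset.single_le_sum (fun j _ => hx.1 j) (Finset.mem_univ i)

lemma norm_le_one_of_mem_simplex {x : Vec k} (hx : x ∈ simplex k) : ‖x‖ ≤ 1 := by
  rw [← sq_le_one_iff₀ (norm_nonneg _), EuclideanSpace.real_norm_sq_eq, ← hx.2]
  exact Finset.sum_le_sum fun i _ => by nlinarith [hx.1 i, le_one_of_mem_simplex hx i]

lemma single_mem_simplex (i : Fin k) : EuclideanSpace.single i (1 : ℝ) ∈ simplex k := by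
  refine ⟨fun j => ?_, by simp⟩
  rw [EuclideanSpace.single, PiLp.single_apply]
  split_ifs <;> norm_num

lemma projSimplex_spec (hk : (simplex k).Nonempty) (u : Vec k) :
    projSimplex u ∈ simplex k ∧ ∀ q ∈ simplex k, ‖u - projSimplex u‖ ≤ ‖u - q‖ := by
  obtain ⟨y, hy, h⟩ := (isClosed_simplex k).exists_infDist_eq_dist hk u
  refine Classical.epsilon_spec
    (p := fun p => p ∈ simplex k ∧ ∀ q ∈ simplex k, ‖u - p‖ ≤ ‖u - q‖) ⟨y, hy, fun q hq => ?_⟩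
  rw [← dist_eq_norm, ← dist_eq_norm, ← h]
  exact Metric.infDist_le_dist_of_mem hq

/-- The obtuse-angle criterion for projection onto a convex set, followed by expanding the square.
-/
lemma norm_projSimplex_sub_le (u : Vec k) {s : Vec k} (hs : s ∈ simplex k) :
    ‖projSimplex u - s‖ ≤ ‖u - s‖ := by
  obtain ⟨hp, hmin⟩ := projSimplex_spec ⟨s, hs⟩ u
  set p := projSimplex u
  have : Nonempty (simplex k) := ⟨⟨s, hs⟩⟩
  have hinf : ‖u - p‖ = ⨅ w : simplex k, ‖u - w‖ :=
    le_antisymm (le_ciInf fun w => hmin w w.2)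
      (ciInf_le ⟨0, by rintro _ ⟨w, rfl⟩; exact norm_nonneg _⟩ (⟨p, hp⟩ : simplex k))
  have h := (norm_eq_iInf_iff_real_inner_le_zero (convex_simplex k) hp).1 hinf s hs
  rw [← sq_le_sq₀ (norm_nonneg _) (norm_nonneg _)]
  have e : u - s = (u - p) + (p - s) := by abel
  rw [e, norm_add_sq_real]
  rw [← neg_sub p s, inner_neg_right] at h
  nlinarith [sq_nonneg ‖u - p‖]

/-- A subspace meeting the relative interior of the simplex is linearly regular with respect to
the simplex. -/
lemma exists_linear_regularity (L : Submodule ℝ (Vec k)) {c : Vec k} (hcL : c ∈ L)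
    (hc : c ∈ simplex k) (hpos : ∀ i, 0 < c i) :
    ∃ κ : ℝ, 1 < κ ∧ ∀ x ∈ simplex k, ∀ p ∈ L, ∃ q ∈ (L : Set (Vec k)) ∩ simplex k,
      ‖x - q‖ ≤ κ * ‖x - p‖ := by
  obtain ⟨m, hm, hmc⟩ : ∃ m : ℝ, 0 < m ∧ ∀ i, m ≤ c i := by
    rcases isEmpty_or_nonempty (Fin k) with h | h
    · exact ⟨1, one_pos, fun i => h.elim i⟩
    · obtain ⟨i, hi⟩ := Finite.exists_min fun i => c i
      exact ⟨c i, hpos i, hi⟩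
  refine ⟨(1 + k) * (1 + 2 / m), ?_, fun x hx p hp => ?_⟩
  · have h1 : (0 : ℝ) ≤ k := by positivity
    have h2 : 0 < 2 / m := by positivity
    nlinarith
  set d := ‖x - p‖
  have hd : 0 ≤ d := norm_nonneg _
  have hcoord : ∀ i, |x i - p i| ≤ d := fun i => by
    simpa using PiLp.norm_apply_le (x - p) i
  set e := 1 - ∑ i, p i
  have he : |e| ≤ k * d := by
    have : e = ∑ i, (x i - p i) := by rw [Finset.sum_sub_distrib, hx.2]
    rw [this]
    refine (Finset.abs_sum_le_sum_abs _ _).trans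
      ((Finset.sum_le_card_nsmul _ _ d fun i _ => hcoord i).trans (by simp))
  -- Moving along `c` keeps the point in `L` and restores coordinate sum 1; the result stays within
  -- `r` of `x`, so its coordinates are at least `-r`.
  set p' := p + e • c with hp'
  set r := (1 + k) * d
  have hr : 0 ≤ r := by positivity
  have hxp' : ‖x - p'‖ ≤ r := by
    have h1 : x - p' = (x - p) - e • c := by rw [hp']; abel
    have h2 : ‖e • c‖ ≤ k * d := by
      rw [norm_smul, Real.norm_eq_abs]
      calc |e| * ‖c‖ ≤ k * d * 1 := by gcongr; exact norm_le_one_of_mem_simplex hc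
        _ = _ := mul_one _
    rw [h1]
    refine (norm_sub_le _ _).trans ?_
    simp only [r]
    linarith
  have hcoord' : ∀ i, -r ≤ p' i := fun i => by
    have h1 : |x i - p' i| ≤ ‖x - p'‖ := by simpa using PiLp.norm_apply_le (x - p') i
    have h2 := (abs_le.1 (h1.trans hxp')).2
    linarith [hx.1 i]
  have hsum : ∑ i, p' i = 1 := by
    simp [hp', Finset.sum_add_distrib, ← Finset.mul_sum, hc.2, e]
  -- The weight on `c` that lifts all coordinates to nonnegative values, since `θ * c i ≥ r`.
  set θ := r / m
  have hθ : 0 ≤ θ := by positivity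
  have hθ1 : 0 < 1 + θ := by positivity
  refine ⟨(1 + θ)⁻¹ • (p' + θ • c), ⟨?_, fun i => ?_, ?_⟩, ?_⟩
  · exact L.smul_mem _ (L.add_mem (L.add_mem hp (L.smul_mem _ hcL)) (L.smul_mem _ hcL))
  · have h1 : r = θ * m := by simp only [θ]; field_simp
    have h2 := hcoord' i
    have h3 := mul_le_mul_of_nonneg_left (hmc i) hθ
    simp only [PiLp.smul_apply, PiLp.add_apply, smul_eq_mul]
    exact mul_nonneg (by positivity) (by linarith)
  · simp only [PiLp.smul_apply, PiLp.add_apply, smul_eq_mul, ← Finset.mul_sum,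
      Finset.sum_add_distrib, hsum, hc.2]
    field_simp
  · have h1 : x - (1 + θ)⁻¹ • (p' + θ • c) = (1 + θ)⁻¹ • ((x - p') + θ • (x - c)) := by
      have : x = (1 + θ)⁻¹ • ((1 + θ) • x) := by rw [smul_smul, inv_mul_cancel₀ hθ1.ne', one_smul]
      nth_rewrite 1 [this]
      rw [← smul_sub]
      congr 1
      module
    rw [h1, norm_smul, norm_inv, Real.norm_of_nonneg hθ1.le]
    have h2 : ‖(x - p') + θ • (x - c)‖ ≤ r + θ * 2 := by
      refine (norm_add_le _ _).trans (add_le_add hxp' ?_)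
      rw [norm_smul, Real.norm_of_nonneg hθ]
      gcongr
      refine (norm_sub_le _ _).trans ?_
      linarith [norm_le_one_of_mem_simplex hx, norm_le_one_of_mem_simplex hc]
    have h3 : (1 + θ)⁻¹ ≤ 1 := inv_le_one_of_one_le₀ (by linarith)
    calc (1 + θ)⁻¹ * ‖(x - p') + θ • (x - c)‖ ≤ 1 * (r + θ * 2) := by gcongr
      _ = (1 + k) * (1 + 2 / m) * d := by simp only [θ, r]; field_simp

/-- One cycle of inexact alternating projections contracts the distance to the intersection. -/
lemma exists_contraction (L : Submodule ℝ (Vec k)) {c : Vec k} (hcL : c ∈ L)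
    (hc : c ∈ simplex k) (hpos : ∀ i, 0 < c i) :
    ∃ α : ℝ, 0 < α ∧ α < 1 ∧ ∀ x ∈ simplex k, ∀ u : Vec k, ∀ δ : ℝ,
      ‖u - L.starProjection x‖ ≤ δ →
      Metric.infDist (projSimplex u) ((L : Set (Vec k)) ∩ simplex k) ≤
        α * Metric.infDist x ((L : Set (Vec k)) ∩ simplex k) + δ := by
  obtain ⟨κ, hκ, hreg⟩ := exists_linear_regularity L hcL hc hpos
  have hκ2 : 0 < 1 - (κ⁻¹) ^ 2 := by
    have h1 : κ⁻¹ < 1 := inv_lt_one_of_one_lt₀ hκ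
    have h2 : 0 < κ⁻¹ := by positivity
    nlinarith
  have hκ3 : 0 < (κ⁻¹) ^ 2 := by positivity
  refine ⟨√(1 - (κ⁻¹) ^ 2), Real.sqrt_pos.2 hκ2, ?_, fun x hx u δ hu => ?_⟩
  · rw [Real.sqrt_lt' one_pos]; linarith
  have hcl : IsClosed ((L : Set (Vec k)) ∩ simplex k) :=
    L.closed_of_finiteDimensional.inter (isClosed_simplex k)
  obtain ⟨s, hs, hsd⟩ := hcl.exists_infDist_eq_dist ⟨c, hcL, hc⟩ x
  set p := L.starProjection x
  have hpL : p ∈ L := L.starProjection_apply_mem x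
  obtain ⟨q, hq, hqd⟩ := hreg x hx p hpL
  have hD : ‖x - s‖ ≤ κ * ‖x - p‖ := by
    rw [← dist_eq_norm, ← hsd]
    refine (Metric.infDist_le_dist_of_mem hq).trans ?_
    rwa [dist_eq_norm]
  have hD' : κ⁻¹ * ‖x - s‖ ≤ ‖x - p‖ := by
    rw [inv_mul_le_iff₀ (by positivity)]; exact hD
  have horth : ⟪x - p, p - s⟫ = 0 := by
    exact L.starProjection_inner_eq_zero x _ (L.sub_mem hpL hs.1)
  -- Regularity makes `‖x - p‖` at least the fraction `κ⁻¹` of `‖x - s‖`, so by Pythagoras the other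
  -- leg is shorter by the factor `√(1 - κ⁻²)`.
  have hpyth : ‖x - s‖ ^ 2 = ‖x - p‖ ^ 2 + ‖p - s‖ ^ 2 := by
    have e : x - s = (x - p) + (p - s) := by abel
    rw [e, norm_add_sq_real, horth]
    ring
  have hps : ‖p - s‖ ≤ √(1 - (κ⁻¹) ^ 2) * ‖x - s‖ := by
    rw [← sq_le_sq₀ (norm_nonneg _) (by positivity), mul_pow, Real.sq_sqrt hκ2.le]
    have := pow_le_pow_left₀ (by positivity) hD' 2
    rw [mul_pow] at this
    linarith
  calc Metric.infDist (projSimplex u) ((L : Set (Vec k)) ∩ simplex k)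
      ≤ ‖projSimplex u - s‖ := by
        rw [← dist_eq_norm]; exact Metric.infDist_le_dist_of_mem hs
    _ ≤ ‖u - s‖ := norm_projSimplex_sub_le u hs.2
    _ ≤ ‖u - p‖ + ‖p - s‖ := norm_sub_le_norm_sub_add_norm_sub _ _ _
    _ ≤ √(1 - (κ⁻¹) ^ 2) * Metric.infDist x ((L : Set (Vec k)) ∩ simplex k) + δ := by
        rw [hsd, dist_eq_norm]; linarith

end Simplex

/-- A perturbed geometric recursion. -/
lemma le_of_perturbed_contraction {α δ D : ℝ} {d : ℕ → ℝ} (h0 : 0 ≤ α) (h1 : α < 1) (hδ : 0 ≤ δ)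
    (hD : d 0 ≤ D) (hd : ∀ k, d (k + 1) ≤ α * d k + δ) (k : ℕ) :
    d k ≤ D * α ^ k + δ / (1 - α) := by
  have h2 : 0 < 1 - α := by linarith
  induction k with
  | zero => have : 0 ≤ δ / (1 - α) := by positivity
            simp; linarith
  | succ k ih =>
    -- `δ / (1 - α)` is the fixed point of `d ↦ α d + δ`.
    have e : δ = (1 - α) * (δ / (1 - α)) := by field_simp
    calc d (k + 1) ≤ α * (D * α ^ k + δ / (1 - α)) + (1 - α) * (δ / (1 - α)) := by
          rw [← e]; exact (hd k).trans (by gcongr)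
      _ = _ := by ring

/-! ### The game with an interior equilibrium and value zero -/

section Game

variable {n m : ℕ} (A : Matrix (Fin n) (Fin m) ℝ)

lemma act_apply (y : Vec m) (i : Fin n) : act A y i = ∑ j, A i j * y j := by
  simp [act, Matrix.toLpLin_apply, Matrix.mulVec, dotProduct]

lemma payoff_eq_inner (x : Vec n) (y : Vec m) : payoff A x y = ⟪x, act A y⟫ := by
  rw [PiLp.inner_apply]
  simp only [act_apply, payoff, RCLike.inner_apply, conj_trivial, Finset.sum_mul]
  exact Finset.sum_congr rfl fun i _ => Finset.sum_congr rfl fun j _ => by ring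

lemma payoff_transpose (x : Vec n) (y : Vec m) : payoff A.transpose y x = payoff A x y := by
  unfold payoff
  rw [Finset.sum_comm]
  exact Finset.sum_congr rfl fun i _ => Finset.sum_congr rfl fun j _ => by
    rw [Matrix.transpose_apply]; ring

lemma payoff_eq_inner_transpose (x : Vec n) (y : Vec m) :
    payoff A x y = ⟪act A.transpose x, y⟫ := by
  rw [← payoff_transpose, payoff_eq_inner, real_inner_comm]

lemma norm_act_le (y : Vec m) : ‖act A y‖ ≤ specNorm A * ‖y‖ :=
  (LinearMap.toContinuousLinearMap (act A)).le_opNorm y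

lemma specNorm_nonneg : 0 ≤ specNorm A := norm_nonneg _

lemma norm_act_transpose_le (x : Vec n) : ‖act A.transpose x‖ ≤ specNorm A * ‖x‖ := by
  have h : ‖act A.transpose x‖ ^ 2 ≤ (specNorm A * ‖x‖) * ‖act A.transpose x‖ := by
    rw [← real_inner_self_eq_norm_sq, ← payoff_eq_inner_transpose, payoff_eq_inner]
    refine (real_inner_le_norm _ _).trans ?_
    have := mul_le_mul_of_nonneg_left (norm_act_le A (act A.transpose x)) (norm_nonneg x)
    linarith
  rcases (norm_nonneg (act A.transpose x)).eq_or_lt with h0 | h0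
  · rw [← h0]; exact mul_nonneg (specNorm_nonneg A) (norm_nonneg x)
  · exact le_of_mul_le_mul_right (by rwa [← sq]) h0

lemma abs_payoff_le (x : Vec n) (y : Vec m) : |payoff A x y| ≤ specNorm A * ‖x‖ * ‖y‖ := by
  rw [payoff_eq_inner]
  refine (abs_real_inner_le_norm _ _).trans ?_
  have := mul_le_mul_of_nonneg_left (norm_act_le A y) (norm_nonneg x)
  linarith

lemma specNorm_pos (hA : A ≠ 0) : 0 < specNorm A := by
  refine (specNorm_nonneg A).lt_of_ne fun h => hA ?_
  have h0 : act A = 0 := by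
    ext1 y
    have := norm_act_le A y
    rw [← h, zero_mul] at this
    simpa using this
  exact (Matrix.toEuclideanLin (𝕜 := ℝ)).map_eq_zero_iff.1 h0

variable {A}

lemma IsNash.payoff_eq_value {x : Vec n} {y : Vec m} (h : IsNash A x y) :
    payoff A x y = value A := by
  obtain ⟨hx, hy, h1, h2⟩ := h
  have : Nonempty (simplex n) := ⟨⟨x, hx⟩⟩
  have : Nonempty (simplex m) := ⟨⟨y, hy⟩⟩
  have hb : ∀ x' : simplex n, BddAbove (Set.range fun y' : simplex m => payoff A x' y') := by
    intro x'
    refine ⟨specNorm A, ?_⟩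
    rintro _ ⟨y', rfl⟩
    refine (le_abs_self _).trans ((abs_payoff_le A _ _).trans ?_)
    have := mul_le_one₀ (norm_le_one_of_mem_simplex x'.2) (norm_nonneg _)
      (norm_le_one_of_mem_simplex y'.2)
    rw [mul_assoc]
    exact mul_le_of_le_one_right (specNorm_nonneg A) this
  have hl : ∀ x' : simplex n, payoff A x y ≤ ⨆ y' : simplex m, payoff A x' y' := fun x' =>
    (h2 x' x'.2).trans (le_ciSup (hb x') (⟨y, hy⟩ : simplex m))
  refine le_antisymm (le_ciInf hl) ((ciInf_le ⟨payoff A x y, ?_⟩ (⟨x, hx⟩ : simplex n)).trans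
    (ciSup_le fun y' => h1 y' y'.2))
  rintro _ ⟨x', rfl⟩
  exact hl x'

/-- Complementary slackness: pure strategies show that the entries of `A y` are nonnegative, and
their average with the positive weights `x` is zero. -/
lemma act_eq_zero_of_interior {x : Vec n} {y : Vec m} (hpos : ∀ i, 0 < x i)
    (h0 : payoff A x y = 0) (h : ∀ x' ∈ simplex n, 0 ≤ payoff A x' y) : act A y = 0 := by
  have h1 : ∀ i, 0 ≤ act A y i := fun i => by
    have := h _ (single_mem_simplex i)
    rw [payoff_eq_inner] at this
    simpa [EuclideanSpace.inner_single_left] using this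
  have h2 : ∑ i, x i * act A y i = 0 := by
    rw [← h0, payoff_eq_inner, PiLp.inner_apply]
    exact Finset.sum_congr rfl fun i _ => by simp [mul_comm]
  have h3 := (Finset.sum_eq_zero_iff_of_nonneg
    fun i _ => mul_nonneg (hpos i).le (h1 i)).1 h2
  ext i
  simpa using (mul_eq_zero.1 (h3 i (Finset.mem_univ i))).resolve_left (hpos i).ne'

/-- The interior equilibrium of a game of value zero lies in the kernels of `Aᵀ` and `A`. -/
lemma exists_interior_kernel (h : HasInteriorEquilibrium A) (hv : value A = 0) :
    ∃ x ∈ simplex n, ∃ y ∈ simplex m, (∀ i, 0 < x i) ∧ (∀ j, 0 < y j) ∧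
      act A.transpose x = 0 ∧ act A y = 0 := by
  obtain ⟨x, y, hN, hxp, hyp⟩ := h
  have h0 : payoff A x y = 0 := hN.payoff_eq_value.trans hv
  obtain ⟨hx, hy, h1, h2⟩ := hN
  refine ⟨x, hx, y, hy, hxp, hyp, ?_, act_eq_zero_of_interior hxp h0 (by rwa [h0] at h2)⟩
  -- Exchanging the players turns the game into that of `-Aᵀ`.
  have h3 : act (-A.transpose) x = 0 := by
    have hneg : ∀ y', payoff (-A.transpose) y' x = -payoff A x y' := fun y' => by
      rw [← payoff_transpose A]; simp [payoff]
    refine act_eq_zero_of_interior (y := x) (x := y) hyp (by rw [hneg, h0, neg_zero])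
      fun y' hy' => ?_
    rw [hneg]
    linarith [h1 y' hy']
  have h4 : act (-A.transpose) = -act A.transpose := by simp [act]
  rwa [h4, LinearMap.neg_apply, neg_eq_zero] at h3

/-- The set of equilibrium strategies of one player, given by the kernel of the action. -/
def kerSimplex (B : Matrix (Fin m) (Fin n) ℝ) : Set (Vec n) :=
  (LinearMap.ker (act B) : Set (Vec n)) ∩ simplex n

lemma abs_payoff_le_infDist (B : Matrix (Fin n) (Fin m) ℝ) (hne : (kerSimplex B).Nonempty)
    {x : Vec n} (hx : x ∈ simplex n) (y : Vec m) :
    |payoff B x y| ≤ specNorm B * Metric.infDist y (kerSimplex B) := by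
  have hcl : IsClosed (kerSimplex B) :=
    (LinearMap.ker (act B)).closed_of_finiteDimensional.inter (isClosed_simplex m)
  obtain ⟨s, hs, hd⟩ := hcl.exists_infDist_eq_dist hne y
  have hs0 : act B s = 0 := hs.1
  have e : payoff B x y = payoff B x (y - s) := by
    rw [payoff_eq_inner, payoff_eq_inner, map_sub, hs0, sub_zero]
  rw [e, hd, dist_eq_norm]
  refine (abs_payoff_le B _ _).trans ?_
  have := mul_le_of_le_one_right (specNorm_nonneg B) (norm_le_one_of_mem_simplex hx)
  gcongr

end Game

/-! ### The rate of convergence of OGDA -/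

section Rate

/-- A sequence with a geometric error bound cannot converge linearly at a slower rate. -/
lemma ConvergesLinearly.rate_le {E : Type*} [NormedAddCommGroup E] {u : ℕ → E} {l p : E}
    {r ρ K : ℝ} (hρ0 : 0 < ρ) (hρ1 : ρ < 1) (hK : ∀ t, ‖u t - p‖ ≤ K * ρ ^ t)
    (h : ConvergesLinearly u l r) : r ≤ ρ := by
  obtain ⟨hr0, hr1, hlim⟩ := h
  have hup : Tendsto u atTop (𝓝 p) := by
    rw [tendsto_iff_norm_sub_tendsto_zero]
    refine squeeze_zero (fun _ => norm_nonneg _) hK ?_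
    simpa using (tendsto_pow_atTop_nhds_zero_of_lt_one hρ0.le hρ1).const_mul K
  -- Otherwise the error quotients would tend to 1, against `r < 1`.
  have hl : p = l := by
    by_contra hne
    have hb : ‖p - l‖ ≠ 0 := norm_ne_zero_iff.2 (sub_ne_zero.2 hne)
    have h1 : Tendsto (fun t => ‖u t - l‖) atTop (𝓝 ‖p - l‖) := (hup.sub_const l).norm
    have h2 := ((tendsto_add_atTop_iff_nat 1).2 h1).div h1 hb
    rw [div_self hb] at h2
    exact hr1.ne (tendsto_nhds_unique hlim h2)
  subst hl
  by_contra hlt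
  push Not at hlt
  obtain ⟨r', h1, h2⟩ := exists_between hlt
  have hr' : 0 < r' := hρ0.trans h1
  obtain ⟨N, hN⟩ := eventually_atTop.1 (hlim.eventually (lt_mem_nhds h2))
  -- A vanishing error would make the quotient 0 by convention, below `r'`.
  have hpos : ∀ t, N ≤ t → 0 < ‖u t - p‖ := fun t ht => by
    refine (norm_nonneg _).lt_of_ne fun h0 => ?_
    have := hN t ht
    rw [← h0, div_zero] at this
    linarith
  have hgrow : ∀ k, r' ^ k * ‖u N - p‖ ≤ ‖u (N + k) - p‖ := by
    intro k
    induction k with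
    | zero => simp
    | succ k ih =>
      have h3 := (lt_div_iff₀ (hpos (N + k) (by omega))).1 (hN (N + k) (by omega))
      calc r' ^ (k + 1) * ‖u N - p‖ = r' * (r' ^ k * ‖u N - p‖) := by ring
        _ ≤ r' * ‖u (N + k) - p‖ := by gcongr
        _ ≤ _ := h3.le
  have hratio : 1 < r' / ρ := (one_lt_div hρ0).2 h1
  obtain ⟨k, hk⟩ := ((tendsto_pow_atTop_atTop_of_one_lt hratio).eventually_gt_atTop
    (K * ρ ^ N / ‖u N - p‖)).exists
  rw [div_lt_iff₀ (hpos N le_rfl), div_pow, div_mul_eq_mul_div, lt_div_iff₀ (by positivity)] at hk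
  have h4 := (hgrow k).trans (hK (N + k))
  rw [pow_add] at h4
  linarith

/-! ### OGDA as the optimistic iteration of one skew-adjoint operator. -/

variable {n m : ℕ} (A : Matrix (Fin n) (Fin m) ℝ)

/-- The joint vector field `(x, y) ↦ (-A y, Aᵀ x)`. -/
def gameOp : WithLp 2 (Vec n × Vec m) →ₗ[ℝ] WithLp 2 (Vec n × Vec m) where
  toFun z := WithLp.toLp 2 (-(act A z.snd), act A.transpose z.fst)
  map_add' z w := by
    rw [WithLp.add_fst, WithLp.add_snd, map_add, map_add, neg_add, ← Prod.mk_add_mk,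
      WithLp.toLp_add]
  map_smul' c z := by
    rw [RingHom.id_apply, WithLp.smul_fst, WithLp.smul_snd, map_smul, map_smul, ← smul_neg,
      ← Prod.smul_mk, WithLp.toLp_smul]

lemma isSkew_gameOp : IsSkew (gameOp A) := by
  intro z w
  simp only [gameOp, LinearMap.coe_mk, AddHom.coe_mk, WithLp.prod_inner_apply, inner_neg_left,
    inner_neg_right]
  change -⟪act A z.snd, w.fst⟫ + ⟪act A.transpose z.fst, w.snd⟫ =
    -(-⟪z.fst, act A w.snd⟫ + ⟪z.snd, act A.transpose w.fst⟫)
  rw [← payoff_eq_inner_transpose, ← payoff_eq_inner, real_inner_comm, ← payoff_eq_inner,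
    real_inner_comm, ← payoff_eq_inner_transpose]
  ring

lemma norm_gameOp_le (z : WithLp 2 (Vec n × Vec m)) : ‖gameOp A z‖ ≤ specNorm A * ‖z‖ := by
  have hγ := specNorm_nonneg A
  rw [← sq_le_sq₀ (norm_nonneg _) (by positivity), mul_pow, WithLp.prod_norm_sq_eq_of_L2,
    WithLp.prod_norm_sq_eq_of_L2]
  have h1 := pow_le_pow_left₀ (norm_nonneg _) (norm_act_le A z.snd) 2
  have h2 := pow_le_pow_left₀ (norm_nonneg _) (norm_act_transpose_le A z.fst) 2
  rw [mul_pow] at h1 h2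
  change ‖-(act A z.snd)‖ ^ 2 + ‖act A.transpose z.fst‖ ^ 2 ≤ _
  rw [norm_neg]
  linarith

lemma gameOp_eq_zero_iff {z : WithLp 2 (Vec n × Vec m)} :
    gameOp A z = 0 ↔ act A.transpose z.fst = 0 ∧ act A z.snd = 0 := by
  rw [← norm_eq_zero, ← sq_eq_zero_iff, WithLp.prod_norm_sq_eq_of_L2]
  change ‖-(act A z.snd)‖ ^ 2 + ‖act A.transpose z.fst‖ ^ 2 = 0 ↔ _
  rw [norm_neg, add_eq_zero_iff_of_nonneg (sq_nonneg _) (sq_nonneg _), sq_eq_zero_iff,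
    sq_eq_zero_iff, norm_eq_zero, norm_eq_zero, and_comm]

lemma gameOp_ne_zero (hA : A ≠ 0) : gameOp A ≠ 0 := by
  intro h
  refine hA ((Matrix.toEuclideanLin (𝕜 := ℝ)).map_eq_zero_iff.1 ?_)
  ext1 y
  exact ((gameOp_eq_zero_iff A (z := WithLp.toLp 2 (0, y))).1 (by rw [h]; rfl)).2

lemma toLp_ogdaStep (η : ℝ) (z w : Vec n × Vec m) :
    WithLp.toLp 2 (ogdaStep A η z w) = WithLp.toLp 2 z + (2 * η) • gameOp A (WithLp.toLp 2 z) -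
      η • gameOp A (WithLp.toLp 2 w) := by
  change _ = WithLp.toLp 2 z + (2 * η) • WithLp.toLp 2 (-(act A z.2), act A.transpose z.1) -
      η • WithLp.toLp 2 (-(act A w.2), act A.transpose w.1)
  rw [← WithLp.toLp_smul, ← WithLp.toLp_smul, ← WithLp.toLp_add, ← WithLp.toLp_sub]
  congr 1
  ext1
  · simp [ogdaStep, sub_eq_add_neg]
  · simp [ogdaStep]

lemma isOptimistic_ogda (η : ℝ) (w z : Vec n × Vec m) :
    IsOptimistic (gameOp A) η fun t => WithLp.toLp 2 (ogda A η w z t) := fun t => by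
  simp only [ogda]
  rw [toLp_ogdaStep]

lemma toLp_ogda_one (η : ℝ) (w z : Vec n × Vec m) :
    WithLp.toLp 2 (ogda A η w z 1) = WithLp.toLp 2 z + (2 * η) • gameOp A (WithLp.toLp 2 z) -
      η • gameOp A (WithLp.toLp 2 w) := by
  simp only [ogda]
  rw [toLp_ogdaStep]

/-- Every optimistic trajectory for `gameOp` is an OGDA trajectory. -/
lemma toLp_ogda_eq {η : ℝ} {z : ℕ → WithLp 2 (Vec n × Vec m)}
    (hz : IsOptimistic (gameOp A) η z) (t : ℕ) :
    WithLp.toLp 2 (ogda A η (z 0).ofLp (z 1).ofLp t) = z (t + 1) := by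
  induction t using Nat.twoStepInduction with
  | zero => simp [ogda]
  | one => rw [toLp_ogda_one, hz]
  | more t h1 h2 =>
    have := isOptimistic_ogda A η (z 0).ofLp (z 1).ofLp t
    simp only at this
    rw [this, h1, h2, ← hz]

/-- The limit of OGDA: the projection of the initial state onto the kernels. -/
def ogdaLimit (z : Vec n × Vec m) : WithLp 2 (Vec n × Vec m) :=
  WithLp.toLp 2 ((LinearMap.ker (act A.transpose)).starProjection z.1,
    (LinearMap.ker (act A)).starProjection z.2)

lemma isKerProj_ogdaLimit (z : Vec n × Vec m) :
    IsKerProj (gameOp A) (WithLp.toLp 2 z) (ogdaLimit A z) := by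
  refine ⟨(gameOp_eq_zero_iff A).2
    ⟨LinearMap.mem_ker.1 ((LinearMap.ker (act A.transpose)).starProjection_apply_mem z.1),
      LinearMap.mem_ker.1 ((LinearMap.ker (act A)).starProjection_apply_mem z.2)⟩, fun q hq => ?_⟩
  obtain ⟨h1, h2⟩ := (gameOp_eq_zero_iff A).1 hq
  have key : ∀ {k : ℕ} (L : Submodule ℝ (Vec k)) (v x : Vec k), v ∈ L →
      ⟪v, x⟫ = ⟪v, L.starProjection x⟫ := fun L v x hv => by
    have := L.starProjection_inner_eq_zero x v hv
    rw [real_inner_comm, inner_sub_right] at this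
    linarith
  rw [WithLp.prod_inner_apply, WithLp.prod_inner_apply]
  exact congrArg₂ (· + ·) (key (LinearMap.ker (act A.transpose)) q.fst z.1 h1)
    (key (LinearMap.ker (act A)) q.snd z.2 h2)

/-- The rate of OGDA is attained, lies in `(1/2, 1)`, and controls the distance to the limit from
states with vanishing history, with an absolute constant. -/
lemma exists_ogdaRate (hA : A ≠ 0) {η : ℝ} (hη : 0 < η) (hη' : η < 1 / (2 * specNorm A)) :
    ∃ ρ : ℝ, 1 / 2 < ρ ∧ ρ < 1 ∧ IsGreatest (ogdaRates A η) ρ ∧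
      ∀ (z : Vec n × Vec m) (t : ℕ),
        ‖WithLp.toLp 2 (ogda A η 0 z (2 * t)) - ogdaLimit A z‖ ≤
          32 * ρ ^ t * ‖WithLp.toLp 2 z‖ := by
  have hM := isSkew_gameOp A
  obtain ⟨e, he⟩ := hM.exists_orthonormalBasis
  have hγ := specNorm_pos A hA
  have hs : ∀ i, η * ‖gameOp A (e i)‖ < 1 / 2 := by
    intro i
    have h1 := norm_gameOp_le A (e i)
    rw [e.norm_eq_one, mul_one] at h1
    rw [lt_div_iff₀ (by positivity)] at hη'
    nlinarith
  obtain ⟨i₁, hi₁⟩ : ∃ i, gameOp A (e i) ≠ 0 := by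
    by_contra! h
    exact gameOp_ne_zero A hA (e.toBasis.ext fun i => by simpa using h i)
  obtain ⟨i₀, hi₀, hmin⟩ := Set.exists_min_image {i | gameOp A (e i) ≠ 0}
    (fun i => ‖gameOp A (e i)‖) (Set.toFinite _) ⟨i₁, hi₁⟩
  have hs0 : 0 < η * ‖gameOp A (e i₀)‖ := mul_pos hη (norm_pos_iff.2 hi₀)
  set ρ := modeRate (η * ‖gameOp A (e i₀)‖) with hρdef
  have hρ2 : 1 / 2 < ρ := half_lt_modeRate _
  have hρ1 : ρ < 1 := modeRate_lt_one hs0 (hs i₀)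
  have hρ0 : 0 < ρ := by linarith
  have hρ : ∀ i, gameOp A (e i) ≠ 0 → modeRate (η * ‖gameOp A (e i)‖) ≤ ρ := fun i hi =>
    modeRate_anti hs0.le (mul_le_mul_of_nonneg_left (hmin i hi) hη.le)
  refine ⟨ρ, hρ2, hρ1, ⟨?_, ?_⟩, fun z t => ?_⟩
  · obtain ⟨z, hz, hn⟩ := (he i₀).exists_trajectory hM hi₀ (e.norm_eq_one i₀) hη.le (hs i₀)
    refine ⟨(z 0).ofLp, (z 1).ofLp, 0, hρ0, hρ1, tendsto_const_nhds.congr fun t => ?_⟩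
    simp only [toLp_ogda_eq A hz, sub_zero, hn]
    rw [← hρdef, pow_succ _ (t + 1), mul_div_assoc, mul_comm, div_mul_cancel₀ _ (by positivity)]
  · rintro r ⟨w, z, l, h⟩
    obtain ⟨K, hK⟩ := exists_norm_sub_le_pow e hM he hη.le hs hρ (isOptimistic_ogda A η w z)
      ⟨(2 * η) • WithLp.toLp 2 z - η • WithLp.toLp 2 w, by
        rw [toLp_ogda_one, map_sub, map_smul, map_smul, add_sub_assoc]; rfl⟩
      (isKerProj_ogdaLimit A z)
    exact h.rate_le hρ0 hρ1 hK
  · exact norm_even_sub_le_pow e hM he hη.le hs hρ hρ0.le hρ1.le (isOptimistic_ogda A η 0 z)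
      (by rw [toLp_ogda_one, WithLp.toLp_zero, map_zero, smul_zero, sub_zero]; rfl)
      (isKerProj_ogdaLimit A z) t

end Rate

/-! ### The algorithm -/

section Algorithm

variable {n m : ℕ} {A : Matrix (Fin n) (Fin m) ℝ}

lemma specNorm_transpose_le (A : Matrix (Fin n) (Fin m) ℝ) : specNorm A.transpose ≤ specNorm A :=
  ContinuousLinearMap.opNorm_le_bound _ (specNorm_nonneg A) (norm_act_transpose_le A)

/-- Points close to the equilibrium strategies form an approximate equilibrium. -/
lemma isApproxNash_of_infDist_le {x : Vec n} {y : Vec m} {D ε : ℝ} (hx : x ∈ simplex n)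
    (hy : y ∈ simplex m) (hx0 : (kerSimplex A.transpose).Nonempty) (hy0 : (kerSimplex A).Nonempty)
    (hxD : Metric.infDist x (kerSimplex A.transpose) ≤ D)
    (hyD : Metric.infDist y (kerSimplex A) ≤ D) (hD : 2 * specNorm A * D ≤ ε) :
    IsApproxNash A ε x y := by
  have hγ := specNorm_nonneg A
  have h1 : ∀ y' ∈ simplex m, |payoff A x y'| ≤ specNorm A * D := fun y' hy' => by
    rw [← payoff_transpose]
    exact (abs_payoff_le_infDist A.transpose hx0 hy' x).trans
      (mul_le_mul (specNorm_transpose_le A) hxD Metric.infDist_nonneg hγ)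
  have h2 : ∀ x' ∈ simplex n, |payoff A x' y| ≤ specNorm A * D := fun x' hx' =>
    (abs_payoff_le_infDist A hy0 hx' y).trans (mul_le_mul_of_nonneg_left hyD hγ)
  refine ⟨hx, hy, fun y' hy' => ?_, fun x' hx' => ?_⟩
  · linarith [(abs_le.1 (h1 y' hy')).2, (abs_le.1 (h1 y hy)).1]
  · linarith [(abs_le.1 (h2 x' hx')).1, (abs_le.1 (h2 x hx)).2]

lemma infDist_kerSimplex_le {B : Matrix (Fin n) (Fin m) ℝ} (h0 : (kerSimplex B).Nonempty)
    {y : Vec m} (hy : y ∈ simplex m) : Metric.infDist y (kerSimplex B) ≤ 2 := by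
  obtain ⟨s, hs⟩ := h0
  refine (Metric.infDist_le_dist_of_mem hs).trans ?_
  rw [dist_eq_norm]
  refine (norm_sub_le _ _).trans ?_
  linarith [norm_le_one_of_mem_simplex hy, norm_le_one_of_mem_simplex hs.2]

lemma altProj_mem {η : ℝ} {T : ℕ} {z : Vec n × Vec m} (h1 : z.1 ∈ simplex n)
    (h2 : z.2 ∈ simplex m) (k : ℕ) :
    (altProj A η T z k).1 ∈ simplex n ∧ (altProj A η T z k).2 ∈ simplex m := by
  cases k with
  | zero => exact ⟨h1, h2⟩
  | succ k => exact ⟨(projSimplex_spec ⟨_, h1⟩ _).1, (projSimplex_spec ⟨_, h2⟩ _).1⟩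

/-- Distance of the iterates of the algorithm to the equilibrium strategies. -/
lemma exists_infDist_altProj_le (h : HasInteriorEquilibrium A) (hv : value A = 0) :
    (kerSimplex A.transpose).Nonempty ∧ (kerSimplex A).Nonempty ∧
    ∃ α : ℝ, 0 < α ∧ α < 1 ∧ ∀ (η ρ : ℝ), 0 ≤ ρ → (∀ (z : Vec n × Vec m) (t : ℕ),
        ‖WithLp.toLp 2 (ogda A η 0 z (2 * t)) - ogdaLimit A z‖ ≤
          32 * ρ ^ t * ‖WithLp.toLp 2 z‖) →
      ∀ (z : Vec n × Vec m), z.1 ∈ simplex n → z.2 ∈ simplex m → ∀ k t : ℕ,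
        Metric.infDist (altProj A η (2 * t) z k).1 (kerSimplex A.transpose) ≤
          2 * α ^ k + 64 * ρ ^ t / (1 - α) ∧
        Metric.infDist (altProj A η (2 * t) z k).2 (kerSimplex A) ≤
          2 * α ^ k + 64 * ρ ^ t / (1 - α) := by
  obtain ⟨x, hx, y, hy, hxp, hyp, hx0, hy0⟩ := exists_interior_kernel h hv
  have hne1 : (kerSimplex A.transpose).Nonempty := ⟨x, hx0, hx⟩
  have hne2 : (kerSimplex A).Nonempty := ⟨y, hy0, hy⟩
  refine ⟨hne1, hne2, ?_⟩
  obtain ⟨α₁, h1, h1', hc1⟩ :=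
    exists_contraction (LinearMap.ker (act A.transpose)) (LinearMap.mem_ker.2 hx0) hx hxp
  obtain ⟨α₂, h2, h2', hc2⟩ :=
    exists_contraction (LinearMap.ker (act A)) (LinearMap.mem_ker.2 hy0) hy hyp
  -- The contraction factors come from the geometry of kernel and simplex alone, hence precede `η`.
  refine ⟨max α₁ α₂, lt_max_of_lt_left h1, max_lt h1' h2', fun η ρ hρ hb z hz1 hz2 k t => ?_⟩
  have hcycle : ∀ k,
      ‖(ogda A η 0 (altProj A η (2 * t) z k) (2 * t)).1 -
        (LinearMap.ker (act A.transpose)).starProjection (altProj A η (2 * t) z k).1‖ ≤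
          64 * ρ ^ t ∧
      ‖(ogda A η 0 (altProj A η (2 * t) z k) (2 * t)).2 -
        (LinearMap.ker (act A)).starProjection (altProj A η (2 * t) z k).2‖ ≤ 64 * ρ ^ t := by
    intro k
    obtain ⟨hm1, hm2⟩ := altProj_mem (A := A) (η := η) (T := 2 * t) hz1 hz2 k
    set v := altProj A η (2 * t) z k
    have hv2 : ‖WithLp.toLp 2 v‖ ≤ 2 := by
      rw [← sq_le_sq₀ (norm_nonneg _) (by norm_num), WithLp.prod_norm_sq_eq_of_L2]
      have e1 : ‖v.1‖ ^ 2 ≤ 1 := pow_le_one₀ (norm_nonneg _) (norm_le_one_of_mem_simplex hm1)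
      have e2 : ‖v.2‖ ^ 2 ≤ 1 := pow_le_one₀ (norm_nonneg _) (norm_le_one_of_mem_simplex hm2)
      change ‖v.1‖ ^ 2 + ‖v.2‖ ^ 2 ≤ _
      linarith
    have hbd : ‖WithLp.toLp 2 (ogda A η 0 v (2 * t)) - ogdaLimit A v‖ ≤ 64 * ρ ^ t := by
      refine (hb v t).trans ?_
      have := mul_le_mul_of_nonneg_left hv2 (show 0 ≤ 32 * ρ ^ t by positivity)
      linarith
    have hsq := WithLp.prod_norm_sq_eq_of_L2
      (WithLp.toLp 2 (ogda A η 0 v (2 * t)) - ogdaLimit A v)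
    have hn := norm_nonneg (WithLp.toLp 2 (ogda A η 0 v (2 * t)) - ogdaLimit A v)
    constructor
    · refine le_trans ?_ hbd
      rw [← sq_le_sq₀ (norm_nonneg _) hn, hsq]
      exact le_add_of_nonneg_right (sq_nonneg _)
    · refine le_trans ?_ hbd
      rw [← sq_le_sq₀ (norm_nonneg _) hn, hsq]
      exact le_add_of_nonneg_left (sq_nonneg _)
  have hα0 : 0 ≤ max α₁ α₂ := h1.le.trans (le_max_left _ _)
  constructor
  · refine le_of_perturbed_contraction
      (d := fun k => Metric.infDist (altProj A η (2 * t) z k).1 (kerSimplex A.transpose))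
      hα0 (max_lt h1' h2') (by positivity) (infDist_kerSimplex_le hne1 hz1) (fun k => ?_) k
    refine (hc1 _ (altProj_mem hz1 hz2 k).1 _ _ (hcycle k).1).trans ?_
    gcongr
    · exact Metric.infDist_nonneg
    · exact le_max_left _ _
    · rfl
  · refine le_of_perturbed_contraction
      (d := fun k => Metric.infDist (altProj A η (2 * t) z k).2 (kerSimplex A))
      hα0 (max_lt h1' h2') (by positivity) (infDist_kerSimplex_le hne2 hz2) (fun k => ?_) k
    refine (hc2 _ (altProj_mem hz1 hz2 k).2 _ _ (hcycle k).2).trans ?_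
    gcongr
    · exact Metric.infDist_nonneg
    · exact le_max_right _ _
    · rfl

end Algorithm

/-! ### Choice of the parameters -/

section Parameters

/-- The number of steps after which a geometric sequence of ratio `ρ` is below `β`. -/
def stepsFor (ρ β : ℝ) : ℕ := ⌈Real.log (1 / β) / Real.log (1 / ρ)⌉₊

lemma pow_stepsFor_le {ρ β : ℝ} (h0 : 0 < ρ) (h1 : ρ < 1) (hβ : 0 < β) :
    ρ ^ stepsFor ρ β ≤ β := by
  have hl : 0 < Real.log (1 / ρ) := Real.log_pos (one_lt_one_div h0 h1)
  have h := (div_le_iff₀ hl).1 (Nat.le_ceil (Real.log (1 / β) / Real.log (1 / ρ)))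
  rw [← Real.log_le_log_iff (by positivity) hβ, Real.log_pow]
  simp only [one_div, Real.log_inv] at h
  simp only [stepsFor, one_div, Real.log_inv]
  linarith

lemma stepsFor_le {ρ β : ℝ} (h1 : ρ < 1) (hβ : 0 < β) (hβρ : β ≤ ρ) :
    (stepsFor ρ β : ℝ) ≤ 2 * (Real.log (1 / β) / Real.log (1 / ρ)) := by
  have h0 : 0 < ρ := hβ.trans_le hβρ
  have hl : 0 < Real.log (1 / ρ) := Real.log_pos (one_lt_one_div h0 h1)
  have h : 1 ≤ Real.log (1 / β) / Real.log (1 / ρ) := by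
    rw [one_le_div hl]
    exact Real.log_le_log (by positivity) (one_div_le_one_div_of_le hβ hβρ)
  have := Nat.ceil_lt_add_one (zero_le_one.trans h)
  unfold stepsFor
  linarith

/-- All conditions hold for `α` close enough to 1, by continuity. The power `q + 1` serves to absorb
the spectral norm in the cycle count, the last inequality to absorb `γ / (1 - α₀)` in the step
count. -/
lemma exists_rate_absorbing {α₀ γ : ℝ} (h1 : α₀ < 1) (q : ℕ) :
    ∃ α : ℝ, 1 / 2 ≤ α ∧ α < 1 ∧ α₀ ≤ α ^ (q + 1) ∧ γ * (1 - α) ≤ 1 - α₀ := by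
  have e1 : ∀ᶠ α : ℝ in 𝓝[<] 1, 1 / 2 ≤ α :=
    (eventually_ge_nhds (by norm_num)).filter_mono nhdsWithin_le_nhds
  have e2 : ∀ᶠ α : ℝ in 𝓝[<] 1, α₀ ≤ α ^ (q + 1) := by
    have : Tendsto (fun α : ℝ => α ^ (q + 1)) (𝓝 1) (𝓝 (1 ^ (q + 1))) :=
      (continuous_pow (q + 1)).tendsto 1
    rw [one_pow] at this
    exact (this.eventually (eventually_ge_nhds h1)).filter_mono nhdsWithin_le_nhds
  have e3 : ∀ᶠ α : ℝ in 𝓝[<] 1, γ * (1 - α) ≤ 1 - α₀ := by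
    have : Tendsto (fun α : ℝ => γ * (1 - α)) (𝓝 1) (𝓝 (γ * (1 - 1))) :=
      (show Continuous fun α : ℝ => γ * (1 - α) by fun_prop).tendsto 1
    rw [sub_self, mul_zero] at this
    exact (this.eventually (eventually_le_nhds (by linarith))).filter_mono nhdsWithin_le_nhds
  obtain ⟨α, ⟨⟨h2, h3⟩, h4⟩, h5⟩ := (((e1.and e2).and e3).and self_mem_nhdsWithin).exists
  exact ⟨α, h2, h5, h3, h4⟩

/-- With these numbers of cycles and steps the error of the algorithm is at most `ε`. -/
lemma error_le {α₀ α γ ρ ε : ℝ} {q : ℕ} (h0 : 0 < α₀) (h1 : α₀ < 1) (hγ : 0 < γ)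
    (hq : 8 * γ ≤ 2 ^ q) (hα : 1 / 2 ≤ α) (hα1 : α < 1) (hαq : α₀ ≤ α ^ (q + 1))
    (hαγ : γ * (1 - α) ≤ 1 - α₀) (hρ : 1 / 2 < ρ) (hρ1 : ρ < 1) (hε : 0 < ε) (hε2 : ε ≤ 1 / 2) :
    2 * γ * (2 * α₀ ^ stepsFor α ε +
      64 * ρ ^ (5 * stepsFor ρ ((1 - α) * ε)) / (1 - α₀)) ≤ ε := by
  have hα0 : 0 < α := by linarith
  have hρ0 : 0 < ρ := by linarith
  have h2 : 0 < 1 - α₀ := by linarith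
  -- Of the `q + 1` factors `ε`, one is kept and the others, each at most `1/2`, cancel `8γ ≤ 2 ^
  -- q`.
  have hfirst : 4 * γ * α₀ ^ stepsFor α ε ≤ ε / 2 := by
    have e1 : α₀ ^ stepsFor α ε ≤ ε ^ (q + 1) :=
      calc α₀ ^ stepsFor α ε ≤ (α ^ (q + 1)) ^ stepsFor α ε := by gcongr
        _ = (α ^ stepsFor α ε) ^ (q + 1) := by rw [← pow_mul, ← pow_mul, mul_comm]
        _ ≤ ε ^ (q + 1) := by gcongr; exact pow_stepsFor_le hα0 hα1 hε
    have e2 : ε ^ q * (8 * γ) ≤ 1 :=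
      calc ε ^ q * (8 * γ) ≤ (1 / 2) ^ q * 2 ^ q := by gcongr
        _ = 1 := by rw [← mul_pow]; norm_num
    calc 4 * γ * α₀ ^ stepsFor α ε ≤ 4 * γ * ε ^ (q + 1) := by gcongr
      _ = (ε ^ q * (8 * γ)) * (ε / 2) := by ring
      _ ≤ 1 * (ε / 2) := by gcongr
      _ = _ := one_mul _
  -- Fivefold steps give `β⁵`: four factors `β ≤ 1/4` reduce 128 to `1/2`, and the fifth supplies
  -- `ε` and the `1 - α` that absorbs `γ`.
  have hsecond : 128 * γ * ρ ^ (5 * stepsFor ρ ((1 - α) * ε)) ≤ (ε / 2) * (1 - α₀) := by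
    set β := (1 - α) * ε with hβdef
    have hβ : 0 < β := mul_pos (by linarith) hε
    have hβ4 : β ≤ 1 / 4 := by nlinarith
    have e1 : ρ ^ (5 * stepsFor ρ β) ≤ (1 / 4) ^ 4 * β :=
      calc ρ ^ (5 * stepsFor ρ β) = (ρ ^ stepsFor ρ β) ^ 5 := by rw [← pow_mul, mul_comm]
        _ ≤ β ^ 5 := by gcongr; exact pow_stepsFor_le hρ0 hρ1 hβ
        _ = β ^ 4 * β := by ring
        _ ≤ (1 / 4) ^ 4 * β := by gcongr
    calc 128 * γ * ρ ^ (5 * stepsFor ρ β) ≤ 128 * γ * ((1 / 4) ^ 4 * β) := by gcongr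
      _ = (ε / 2) * (γ * (1 - α)) := by rw [hβdef]; ring
      _ ≤ (ε / 2) * (1 - α₀) := by gcongr
  have hthird := (div_le_iff₀ h2).2 hsecond
  calc _ = 4 * γ * α₀ ^ stepsFor α ε +
        128 * γ * ρ ^ (5 * stepsFor ρ ((1 - α) * ε)) / (1 - α₀) := by ring
    _ ≤ ε := by linarith

lemma isBigO_iterations {Tp Ts : ℝ → ℕ} {C α lr : ℝ} (hC : 0 < C) (hα : 0 < α) (hα1 : α < 1)
    (hr : 0 < lr)
    (h : ∀ ε : ℝ, 0 < ε → ε ≤ 1 / 2 →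
      (Tp ε : ℝ) ≤ C * (Real.log (1 / ε) / Real.log (1 / α)) ∧
      (Ts ε : ℝ) ≤ C * (Real.log (1 / ((1 - α) * ε)) / lr)) :
    (fun ε : ℝ => (Tp ε : ℝ) * ((Ts ε : ℝ) + 1)) =O[𝓝[>] 0]
      (fun ε : ℝ => Real.log (1 / ε) ^ 2) := by
  have hlα : 0 < Real.log (1 / α) := Real.log_pos (one_lt_one_div hα hα1)
  have hl2 : 0 < Real.log 2 := Real.log_pos one_lt_two
  have h1α : 0 < 1 - α := by linarith
  set c := Real.log (1 / (1 - α))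
  have hc : 0 ≤ c := Real.log_nonneg (by rw [le_div_iff₀ h1α]; linarith)
  refine IsBigO.of_bound
    (C / Real.log (1 / α) * (C / lr * (c / Real.log 2 + 1) + 1 / Real.log 2)) ?_
  have hev : ∀ᶠ ε : ℝ in 𝓝[>] 0, ε ∈ Set.Ioc (0 : ℝ) (1 / 2) :=
    Ioc_mem_nhdsGT (by norm_num)
  filter_upwards [hev] with ε hε
  obtain ⟨hp, hs⟩ := h ε hε.1 hε.2
  have hε0 := hε.1
  set ℓ := Real.log (1 / ε) with hℓ
  have hℓ2 : Real.log 2 ≤ ℓ := by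
    refine Real.log_le_log two_pos ?_
    rw [le_div_iff₀ hε.1]; linarith [hε.2]
  have hlog : Real.log (1 / ((1 - α) * ε)) = c + ℓ := by
    rw [← Real.log_mul (by positivity) (by positivity)]
    congr 1
    field_simp
  -- Lets the additive constants `c` and 1 be absorbed into multiples of `ℓ`.
  have hone : 1 ≤ ℓ / Real.log 2 := (one_le_div hl2).2 hℓ2
  have hs' : (Ts ε : ℝ) + 1 ≤ (C / lr * (c / Real.log 2 + 1) + 1 / Real.log 2) * ℓ :=
    calc (Ts ε : ℝ) + 1 ≤ C * ((c + ℓ) / lr) + 1 := by rw [← hlog]; gcongr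
      _ ≤ C * ((c * (ℓ / Real.log 2) + ℓ) / lr) + ℓ / Real.log 2 := by
        gcongr
        exact le_mul_of_one_le_right hc hone
      _ = _ := by ring
  rw [Real.norm_of_nonneg (by positivity), Real.norm_of_nonneg (by positivity)]
  calc (Tp ε : ℝ) * ((Ts ε : ℝ) + 1) ≤ (C * (ℓ / Real.log (1 / α))) *
        ((C / lr * (c / Real.log 2 + 1) + 1 / Real.log 2) * ℓ) :=
        mul_le_mul hp hs' (by positivity) ((Nat.cast_nonneg _).trans hp)
    _ = _ := by ring

end Parameters

lemma IsApproxNash.mono {n m : ℕ} {A : Matrix (Fin n) (Fin m) ℝ} {ε ε' : ℝ} {x : Vec n} {y : Vec m}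
    (h : IsApproxNash A ε x y) (hε : ε ≤ ε') : IsApproxNash A ε' x y :=
  ⟨h.1, h.2.1, fun y' hy' => (h.2.2.1 y' hy').trans (by linarith),
    fun x' hx' => (h.2.2.2 x' hx').trans (by linarith)⟩

end BilinearGame

end

theorem mainTheorem1 :
    ∃ C : ℝ, 0 < C ∧
      ∀ (n m : ℕ) (A : Matrix (Fin n) (Fin m) ℝ), A ≠ 0 →
        BilinearGame.HasInteriorEquilibrium A → BilinearGame.value A = 0 →
        ∃ α : ℝ, 0 < α ∧ α < 1 ∧
          ∀ η : ℝ, 0 < η → η < 1 / (2 * BilinearGame.specNorm A) →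
            IsGreatest (BilinearGame.ogdaRates A η) (BilinearGame.ogdaRate A η) ∧
            ∃ Tp Ts : ℝ → ℕ,
              (∀ ε : ℝ, 0 < ε → ∀ x₀ ∈ BilinearGame.simplex n, ∀ y₀ ∈ BilinearGame.simplex m,
                BilinearGame.IsApproxNash A ε
                  (BilinearGame.altProj A η (Ts ε) (x₀, y₀) (Tp ε)).1
                  (BilinearGame.altProj A η (Ts ε) (x₀, y₀) (Tp ε)).2) ∧
              (∀ ε : ℝ, 0 < ε → ε ≤ 1 / 2 →
                (Tp ε : ℝ) ≤ C * (Real.log (1 / ε) / Real.log (1 / α)) ∧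
                (Ts ε : ℝ) ≤ C * (Real.log (1 / ((1 - α) * ε)) /
                  Real.log (1 / BilinearGame.ogdaRate A η))) ∧
              (fun ε : ℝ => (Tp ε : ℝ) * ((Ts ε : ℝ) + 1)) =O[𝓝[>] 0]
                (fun ε : ℝ => Real.log (1 / ε) ^ 2) := by
  -- `20 = 2 * 5 * 2`: even step counts, the fivefold steps of `error_le`, and the rounding in
  -- `stepsFor_le`.
  refine ⟨20, by norm_num, fun n m A hA hint hval => ?_⟩
  have hγ := BilinearGame.specNorm_pos A hA
  obtain ⟨hne1, hne2, α₀, hα₀, hα₀1, hdist⟩ :=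
    BilinearGame.exists_infDist_altProj_le hint hval
  obtain ⟨q, hq⟩ := pow_unbounded_of_one_lt (8 * BilinearGame.specNorm A) one_lt_two
  obtain ⟨α, hα2, hα1, hαq, hαγ⟩ :=
    BilinearGame.exists_rate_absorbing (γ := BilinearGame.specNorm A) hα₀1 q
  have hα0 : 0 < α := by linarith
  refine ⟨α, hα0, hα1, fun η hη hη' => ?_⟩
  obtain ⟨ρ, hρ2, hρ1, hgreat, hb⟩ := BilinearGame.exists_ogdaRate A hA hη hη'
  have hρ0 : 0 < ρ := by linarith
  have hrate : BilinearGame.ogdaRate A η = ρ := hgreat.csSup_eq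
  rw [hrate]
  -- For `ε > 1/2` the parameters for accuracy `1/2` are used.
  refine ⟨hgreat, fun ε => BilinearGame.stepsFor α (min ε (1 / 2)),
    fun ε => 2 * (5 * BilinearGame.stepsFor ρ ((1 - α) * min ε (1 / 2))), ?_, ?_⟩
  · intro ε hε x₀ hx₀ y₀ hy₀
    have hmin : 0 < min ε (1 / 2) := lt_min hε (by norm_num)
    obtain ⟨h1, h2⟩ := hdist η ρ hρ0.le hb (x₀, y₀) hx₀ hy₀
      (BilinearGame.stepsFor α (min ε (1 / 2)))
      (5 * BilinearGame.stepsFor ρ ((1 - α) * min ε (1 / 2)))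
    obtain ⟨h3, h4⟩ := BilinearGame.altProj_mem (A := A) (η := η)
      (T := 2 * (5 * BilinearGame.stepsFor ρ ((1 - α) * min ε (1 / 2)))) (z := (x₀, y₀)) hx₀ hy₀
      (BilinearGame.stepsFor α (min ε (1 / 2)))
    exact (BilinearGame.isApproxNash_of_infDist_le h3 h4 hne1 hne2 h1 h2
      (BilinearGame.error_le hα₀ hα₀1 hγ hq.le hα2 hα1 hαq hαγ hρ2 hρ1 hmin
        (min_le_right _ _))).mono (min_le_left _ _)
  · have hbounds : ∀ ε : ℝ, 0 < ε → ε ≤ 1 / 2 →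
        ((BilinearGame.stepsFor α (min ε (1 / 2)) : ℕ) : ℝ) ≤
          20 * (Real.log (1 / ε) / Real.log (1 / α)) ∧
        ((2 * (5 * BilinearGame.stepsFor ρ ((1 - α) * min ε (1 / 2))) : ℕ) : ℝ) ≤
          20 * (Real.log (1 / ((1 - α) * ε)) / Real.log (1 / ρ)) := by
      intro ε hε hε2
      rw [min_eq_left hε2]
      have hβ : 0 < (1 - α) * ε := mul_pos (by linarith) hε
      have h1 := BilinearGame.stepsFor_le hα1 hε (hε2.trans hα2)
      have h2 := BilinearGame.stepsFor_le hρ1 hβ (by nlinarith)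
      have h3 : (0 : ℝ) ≤ BilinearGame.stepsFor α ε := by positivity
      refine ⟨by linarith, ?_⟩
      push_cast
      linarith
    exact ⟨hbounds, BilinearGame.isBigO_iterations (by norm_num) hα0 hα1
      (Real.log_pos (one_lt_one_div hρ0 hρ1)) hbounds⟩
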